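/- Let $H$ and $K$ be separable real Hilbert spaces, let $L$ be the generator of a strongly continuous semigroup $(S(t))_{t\ge 0}$ on $H$, let $Q\colon K\to H$ be a bounded linear operator and let $W$ be a cylindrical Wiener process on $K$. Consider the linear SPDE $$dx = Lx\,dt + Q\,dW(t)\;,\qquad x(0)=x_0\;, \tag{1}$$ and assume that for every $x_0\in H$ it has a mild solution with values in $H$, that is an $H$-valued process $x$ such that, for every $t \ge 0$, almost surely $x(t) = S(t)x_0+\int_0^t S(t-s)Q\,dW(s)$. For $t\ge 0$ and $x\in H$, let $\mathcal P_t(x,\cdot)$ be the law of $S(t)x+\int_0^t S(t-s)Q\,dW(s)$, let $(\mathcal P_t^*\nu)(A)=\int_H \mathcal P_t(x,A)\,\nu(dx)$ for probability measures $\nu$ on $H$, and call a Borel probability measure $\mu$ on $H$ invariant for (1) if $\mathcal P_t^*\mu=\mu$ for every $t>0$. Let $Q_t = \int_0^t S(s)QQ^*S(s)^*\,ds$ and let $Q_t^{1/2}$ be its positive square root. For probability measures $\mu,\nu$ on $H$, write $\|\mu-\nu\|_{\mathrm{TV}} = \sup_\varphi \bigl(\int\varphi\,d\mu-\int\varphi\,d\nu\bigr)$,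 where the supremum runs over the Borel functions $\varphi\colon H\to[-1,1]$. **Theorem.** Suppose that there exists a time $T \ge 0$ such that $\|S(T)\|<1$ and such that $S(T)$ maps $H$ into the image of $Q_T^{1/2}$. Then (1) has a unique invariant measure $\mu_\infty$, and there exists $\gamma>0$ such that, for every probability measure $\nu$ on $H$ with finite second moment, there is a constant $C(\nu)$ with $$\|\mathcal P_t^*\nu-\mu_\infty\|_{\mathrm{TV}}\le C(\nu)\,e^{-\gamma t}\qquad\text{for all } t\ge 0\;.$$ -/

import Mathlib

open MeasureTheory ProbabilityTheory Filter Set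
open scoped NNReal ENNReal Topology InnerProduct

namespace LinearSPDE

/-- A strongly continuous (`C₀`) semigroup of bounded linear operators on `H`, indexed by times
`t ≥ 0`; the values of `S` at negative times play no role. -/
structure IsC0Semigroup {H : Type*} [NormedAddCommGroup H] [NormedSpace ℝ H]
    (S : ℝ → H →L[ℝ] H) : Prop where
  map_zero : S 0 = ContinuousLinearMap.id ℝ H
  map_add : ∀ s t : ℝ, 0 ≤ s → 0 ≤ t → S (s + t) = S s ∘L S t
  continuous : ∀ x : H, ContinuousOn (fun t : ℝ => S t x) (Ici 0)

/-- The unbounded operator `L` is the generator of `S`: its domain consists of all `x` for which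
`t⁻¹ (S(t) x - x)` converges as `t ↓ 0`, and `L x` is this limit. -/
def IsGenerator {H : Type*} [NormedAddCommGroup H] [NormedSpace ℝ H]
    (L : H →ₗ.[ℝ] H) (S : ℝ → H →L[ℝ] H) : Prop :=
  ∀ x y : H, (x, y) ∈ L.graph ↔
    Tendsto (fun t : ℝ => t⁻¹ • (S t x - x)) (𝓝[>] 0) (𝓝 y)

/-- The squared Hilbert-Schmidt norm `∑ᵢ ‖A eᵢ‖²` of a bounded operator, computed in a Hilbert
basis `(eᵢ)` of `K` (the value does not depend on the basis). -/
noncomputable def hsNormSq {K H : Type*} [NormedAddCommGroup K] [InnerProductSpace ℝ K]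
    [CompleteSpace K] [NormedAddCommGroup H] [InnerProductSpace ℝ H]
    (A : K →L[ℝ] H) : ℝ≥0∞ :=
  ∑' e : (exists_hilbertBasis ℝ K).choose, ‖A (e : K)‖ₑ ^ 2

/-- `W` is a cylindrical Wiener process on `K`, realised in a larger Hilbert space `K'` into which
`K` is densely embedded by the Hilbert-Schmidt map `ι`: a centred Gaussian process with values in
`K'` such that `E ⟨h, W(s)⟩ ⟨W(t), k⟩ = (s ∧ t) ⟨ι* h, ι* k⟩`. -/
structure IsCylindricalWiener {Ω K K' : Type*} [MeasurableSpace Ω]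
    [NormedAddCommGroup K] [InnerProductSpace ℝ K] [CompleteSpace K]
    [NormedAddCommGroup K'] [InnerProductSpace ℝ K'] [CompleteSpace K'] [MeasurableSpace K']
    (P : Measure Ω) (ι : K →L[ℝ] K') (W : ℝ≥0 → Ω → K') : Prop where
  injective : Function.Injective ι
  denseRange : DenseRange ι
  hilbertSchmidt : hsNormSq ι < ∞
  gaussian : IsGaussianProcess W P
  centred : ∀ (t : ℝ≥0) (h : K'), ∫ ω, inner ℝ h (W t ω) ∂P = 0
  covariance : ∀ (s t : ℝ≥0) (h k : K'),
    ∫ ω, inner ℝ h (W s ω) * inner ℝ (W t ω) k ∂P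
      = (min s t : ℝ≥0) * inner ℝ ((ContinuousLinearMap.adjoint ι) h)
          ((ContinuousLinearMap.adjoint ι) k)

/-- A deterministic elementary integrand `∑ᵢ Bᵢ ι 1_{(sᵢ, tᵢ]}`. The operators `B ι` with `B`
bounded on `K'` are dense in the Hilbert-Schmidt operators from `K` to `H`, and it is for them that
`(B ι) W(t)` has the obvious meaning `B W(t)`. -/
structure Elementary (K' H : Type*) [NormedAddCommGroup K'] [NormedSpace ℝ K']
    [NormedAddCommGroup H] [NormedSpace ℝ H] where
  n : ℕ
  left : Fin n → ℝ≥0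
  right : Fin n → ℝ≥0
  left_le_right : ∀ i, left i ≤ right i
  B : Fin n → K' →L[ℝ] H

/-- The operator valued step function given by an elementary integrand. -/
noncomputable def Elementary.eval {K K' H : Type*} [NormedAddCommGroup K] [NormedSpace ℝ K]
    [NormedAddCommGroup K'] [NormedSpace ℝ K'] [NormedAddCommGroup H] [NormedSpace ℝ H]
    (Φ : Elementary K' H) (ι : K →L[ℝ] K') (r : ℝ) : K →L[ℝ] H :=
  ∑ i, (Ioc (Φ.left i : ℝ) (Φ.right i : ℝ)).indicator (fun _ => Φ.B i ∘L ι) r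

/-- The stochastic integral `∑ᵢ Bᵢ (W(tᵢ) - W(sᵢ))` of an elementary integrand. -/
noncomputable def Elementary.integral {Ω K' H : Type*}
    [NormedAddCommGroup K'] [NormedSpace ℝ K'] [NormedAddCommGroup H] [NormedSpace ℝ H]
    (Φ : Elementary K' H) (W : ℝ≥0 → Ω → K') (ω : Ω) : H :=
  ∑ i, Φ.B i (W (Φ.right i) ω - W (Φ.left i) ω)

/-- The random variable `Z` is (a version of) the stochastic integral `∫₀^∞ Φ(r) dW(r)` of the
deterministic integrand `Φ`: there are elementary integrands which converge to `Φ` in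
`L²(ℝ₊; L₂(K, H))` and whose stochastic integrals converge to `Z` in `L²(Ω; H)`. By the Itô
isometry `Z` is unique up to almost sure equality. -/
def IsStochIntegral {Ω K K' H : Type*} [MeasurableSpace Ω]
    [NormedAddCommGroup K] [InnerProductSpace ℝ K] [CompleteSpace K]
    [NormedAddCommGroup K'] [InnerProductSpace ℝ K']
    [NormedAddCommGroup H] [InnerProductSpace ℝ H] [MeasurableSpace H]
    (P : Measure Ω) (ι : K →L[ℝ] K') (W : ℝ≥0 → Ω → K') (Φ : ℝ → K →L[ℝ] H) (Z : Ω → H) : Prop :=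
  Measurable Z ∧ ∃ Ψ : ℕ → Elementary K' H,
    Tendsto (fun n => ∫⁻ r in Ioi (0 : ℝ), hsNormSq ((Ψ n).eval ι r - Φ r)) atTop (𝓝 0) ∧
    Tendsto (fun n => eLpNorm (fun ω => (Ψ n).integral W ω - Z ω) 2 P) atTop (𝓝 0)

/-- The integrand `s ↦ S(t - s) Q 1_{(0, t]}(s)` of the stochastic convolution at time `t`. -/
noncomputable def convIntegrand {K H : Type*} [NormedAddCommGroup K] [NormedSpace ℝ K]
    [NormedAddCommGroup H] [NormedSpace ℝ H]
    (S : ℝ → H →L[ℝ] H) (Q : K →L[ℝ] H) (t : ℝ) : ℝ → K →L[ℝ] H :=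
  (Ioc (0 : ℝ) t).indicator (fun s => S (t - s) ∘L Q)

/-- The `H`-valued process `x` is a mild solution of `dx = L x dt + Q dW`, `x(0) = x₀`, where `L`
is the generator of `S`: for every time `t`, almost surely
`x(t) = S(t) x₀ + ∫₀ᵗ S(t - s) Q dW(s)`. -/
def IsMildSolution {Ω K K' H : Type*} [MeasurableSpace Ω]
    [NormedAddCommGroup K] [InnerProductSpace ℝ K] [CompleteSpace K]
    [NormedAddCommGroup K'] [InnerProductSpace ℝ K']
    [NormedAddCommGroup H] [InnerProductSpace ℝ H] [MeasurableSpace H]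
    (P : Measure Ω) (ι : K →L[ℝ] K') (W : ℝ≥0 → Ω → K')
    (S : ℝ → H →L[ℝ] H) (Q : K →L[ℝ] H) (x₀ : H) (x : ℝ → Ω → H) : Prop :=
  ∀ t : ℝ, 0 ≤ t → Measurable (x t) ∧
    ∃ Z : Ω → H, IsStochIntegral P ι W (convIntegrand S Q t) Z ∧
      ∀ᵐ ω ∂P, x t ω = S t x₀ + Z ω

open Classical in
/-- The stochastic convolution `∫₀ᵗ S(t - s) Q dW(s)` (with value `0` if it does not exist). -/
noncomputable def stochConv {Ω K K' H : Type*} [MeasurableSpace Ω]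
    [NormedAddCommGroup K] [InnerProductSpace ℝ K] [CompleteSpace K]
    [NormedAddCommGroup K'] [InnerProductSpace ℝ K']
    [NormedAddCommGroup H] [InnerProductSpace ℝ H] [MeasurableSpace H]
    (P : Measure Ω) (ι : K →L[ℝ] K') (W : ℝ≥0 → Ω → K')
    (S : ℝ → H →L[ℝ] H) (Q : K →L[ℝ] H) (t : ℝ) : Ω → H :=
  if h : ∃ Z, IsStochIntegral P ι W (convIntegrand S Q t) Z then h.choose else 0

theorem measurable_stochConv {Ω K K' H : Type*} [MeasurableSpace Ω]
    [NormedAddCommGroup K] [InnerProductSpace ℝ K] [CompleteSpace K]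
    [NormedAddCommGroup K'] [InnerProductSpace ℝ K']
    [NormedAddCommGroup H] [InnerProductSpace ℝ H] [MeasurableSpace H]
    (P : Measure Ω) (ι : K →L[ℝ] K') (W : ℝ≥0 → Ω → K')
    (S : ℝ → H →L[ℝ] H) (Q : K →L[ℝ] H) (t : ℝ) :
    Measurable (stochConv P ι W S Q t) := by
  unfold stochConv
  split_ifs with h
  · exact h.choose_spec.1
  · exact measurable_const

/-- The transition probabilities of the Markov semigroup `P_t` of the equation: `P_t(x, ·)` is the
law of `S(t) x + ∫₀ᵗ S(t - s) Q dW(s)`. -/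
noncomputable def transition {Ω K K' H : Type*} [MeasurableSpace Ω]
    [NormedAddCommGroup K] [InnerProductSpace ℝ K] [CompleteSpace K]
    [NormedAddCommGroup K'] [InnerProductSpace ℝ K']
    [NormedAddCommGroup H] [InnerProductSpace ℝ H] [SecondCountableTopology H]
    [MeasurableSpace H] [BorelSpace H]
    (P : Measure Ω) [IsProbabilityMeasure P] (ι : K →L[ℝ] K') (W : ℝ≥0 → Ω → K')
    (S : ℝ → H →L[ℝ] H) (Q : K →L[ℝ] H) (t : ℝ) : Kernel H H where
  toFun x := P.map (fun ω => S t x + stochConv P ι W S Q t ω)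
  measurable' := by
    have hZ := measurable_stochConv P ι W S Q t
    have hf : Measurable (fun p : H × Ω => S t p.1 + stochConv P ι W S Q t p.2) :=
      ((S t).measurable.comp measurable_fst).add (hZ.comp measurable_snd)
    refine Measure.measurable_of_measurable_coe _ fun A hA => ?_
    have h : ∀ x : H, P.map (fun ω => S t x + stochConv P ι W S Q t ω) A
        = P (Prod.mk x ⁻¹' ((fun p : H × Ω => S t p.1 + stochConv P ι W S Q t p.2) ⁻¹' A)) :=
      fun x => Measure.map_apply (measurable_const.add hZ) hA
    simp_rw [h]
    exact measurable_measure_prodMk_left (hf hA)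

/-- `P_t^* ν`, given by `(P_t^* ν)(A) = ∫ P_t(x, A) ν(dx)`. -/
noncomputable def evolve {Ω K K' H : Type*} [MeasurableSpace Ω]
    [NormedAddCommGroup K] [InnerProductSpace ℝ K] [CompleteSpace K]
    [NormedAddCommGroup K'] [InnerProductSpace ℝ K']
    [NormedAddCommGroup H] [InnerProductSpace ℝ H] [SecondCountableTopology H]
    [MeasurableSpace H] [BorelSpace H]
    (P : Measure Ω) [IsProbabilityMeasure P] (ι : K →L[ℝ] K') (W : ℝ≥0 → Ω → K')
    (S : ℝ → H →L[ℝ] H) (Q : K →L[ℝ] H) (t : ℝ) (ν : Measure H) : Measure H :=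
  ν.bind (transition P ι W S Q t)

/-- `μ` is an invariant measure of the equation: a probability measure with `P_t^* μ = μ` for
every `t > 0`. -/
def IsInvariantMeasure {Ω K K' H : Type*} [MeasurableSpace Ω]
    [NormedAddCommGroup K] [InnerProductSpace ℝ K] [CompleteSpace K]
    [NormedAddCommGroup K'] [InnerProductSpace ℝ K']
    [NormedAddCommGroup H] [InnerProductSpace ℝ H] [SecondCountableTopology H]
    [MeasurableSpace H] [BorelSpace H]
    (P : Measure Ω) [IsProbabilityMeasure P] (ι : K →L[ℝ] K') (W : ℝ≥0 → Ω → K')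
    (S : ℝ → H →L[ℝ] H) (Q : K →L[ℝ] H) (μ : Measure H) : Prop :=
  IsProbabilityMeasure μ ∧ ∀ t : ℝ, 0 < t → evolve P ι W S Q t μ = μ

/-- The operator `Q_t = ∫₀ᵗ S(s) Q Q* S(s)* ds` on `H`, the integral being taken pointwise. -/
noncomputable def covOp {K H : Type*} [NormedAddCommGroup K] [InnerProductSpace ℝ K]
    [CompleteSpace K] [NormedAddCommGroup H] [InnerProductSpace ℝ H] [CompleteSpace H]
    (S : ℝ → H →L[ℝ] H) (Q : K →L[ℝ] H) (t : ℝ) (x : H) : H :=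
  ∫ s in (0 : ℝ)..t,
    S s (Q ((ContinuousLinearMap.adjoint Q) ((ContinuousLinearMap.adjoint (S s)) x)))

/-- `R` is the positive square root `A^{1/2}` of the operator `A`: the unique bounded positive
selfadjoint operator with `R² = A`. -/
def IsPositiveSqrt {H : Type*} [NormedAddCommGroup H] [InnerProductSpace ℝ H]
    (R : H →L[ℝ] H) (A : H → H) : Prop :=
  R.IsPositive ∧ ∀ x, R (R x) = A x

/-- The total variation distance `sup {∫ φ dμ - ∫ φ dν : |φ| ≤ 1}`, the supremum running over
Borel functions `φ`; it is normalised such that mutually singular probability measures are at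
distance `2`. -/
noncomputable def tvDist {X : Type*} [MeasurableSpace X] (μ ν : Measure X) : ℝ≥0∞ :=
  ⨆ (φ : X → ℝ) (_ : Measurable φ) (_ : ∀ x, |φ x| ≤ 1),
    ENNReal.ofReal (∫ x, φ x ∂μ - ∫ x, φ x ∂ν)

end LinearSPDE

/-! The law of the stochastic convolution at time `t` is the centred Gaussian `N(0, Q_t)`, so `P_t^*
ν` is the convolution of the image of `ν` under `S(t)` with `N(0, Q_t)`. Everything about laws is
then read off from characteristic functions (`charFun_convLaw`, `evolve_eq_conv`) and the identity
`Q_{s+t} = Q_s + S(s) Q_t S(s)*` (`covForm_add`).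

Since `‖S(T)‖ < 1`, the series `∑ S(T)ⁿ Zₙ` with independent `Zₙ` of law `N(0, Q_T)` converges
almost surely. Its law is invariant and has a finite first moment (`exists_isInvariantMeasure`). It
is the only invariant measure because `S(NT)` contracts every initial law to the Dirac mass at `0`.

The rate comes from a strong Feller estimate. By the closed graph theorem, `S(T) y = Q_T^{1/2} h`
with `‖h‖ ≤ C ‖y‖` (`exists_preimage_norm_le`), and by Cameron-Martin a shift by `Q_T^{1/2} h` moves
`N(0, Q_T)` by at most `2 ‖h‖` in total variation (`tvClose_map_add`). As `N(0, Q_{T+s})` has `N(0,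
Q_T)` as a convolution factor, applying this to `y = S(s) x` shows that the laws started at `x` and
at `0` differ at time `T + s` by at most `2 C ‖S(s)‖ ‖x‖`, which decays exponentially in `s`.
Averaging over `x` compares both `ν` and the invariant measure with the process started at `0`; only
first moments are needed. -/

namespace LinearSPDE

/-! ### Weak measurability in separable Hilbert spaces -/

section WeakMeasurability

variable {α E : Type*} [MeasurableSpace α] [NormedAddCommGroup E] [InnerProductSpace ℝ E]
  [SecondCountableTopology E]

/-- Exhibits a closed ball as a countable intersection of half-spaces. The nontrivial direction
extends the inequality by density to the test vector `y` itself. -/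
theorem norm_le_iff_forall_inner_denseSeq_le (y : E) {r : ℝ} (hr : 0 ≤ r) :
    ‖y‖ ≤ r ↔ ∀ n, inner ℝ (TopologicalSpace.denseSeq E n) y
      ≤ r * ‖TopologicalSpace.denseSeq E n‖ := by
  constructor
  · intro h n
    calc _ ≤ ‖TopologicalSpace.denseSeq E n‖ * ‖y‖ := real_inner_le_norm _ _
      _ ≤ _ := by rw [mul_comm]; gcongr
  · intro h
    have hcl : IsClosed {x : E | inner ℝ x y ≤ r * ‖x‖} :=
      isClosed_le (by fun_prop) (by fun_prop)
    have hc : y ∈ {x : E | inner ℝ x y ≤ r * ‖x‖} := by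
      have hy : y ∈ closure (range (TopologicalSpace.denseSeq E)) :=
        TopologicalSpace.denseRange_denseSeq E y
      exact closure_minimal (by rintro _ ⟨n, rfl⟩; exact h n) hcl hy
    rw [mem_ofPred_eq, real_inner_self_eq_norm_mul_norm] at hc
    rcases (norm_nonneg y).eq_or_lt with hy | hy
    · rwa [← hy]
    · exact le_of_mul_le_mul_right hc hy

/-- A weakly measurable function with values in a separable Hilbert space is measurable. -/
theorem measurable_of_forall_inner [MeasurableSpace E] [BorelSpace E] {f : α → E}
    (hf : ∀ x : E, Measurable fun a => inner ℝ x (f a)) : Measurable f := by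
  have hball : ∀ (x : E) (r : ℝ), 0 ≤ r → MeasurableSet (f ⁻¹' Metric.closedBall x r) := by
    intro x r hr
    have : f ⁻¹' Metric.closedBall x r = ⋂ n, {a | inner ℝ (TopologicalSpace.denseSeq E n) (f a)
        - inner ℝ (TopologicalSpace.denseSeq E n) x ≤ r * ‖TopologicalSpace.denseSeq E n‖} := by
      ext a
      simp only [mem_preimage, mem_closedBall_iff_norm, mem_iInter, mem_ofPred_eq,
        norm_le_iff_forall_inner_denseSeq_le _ hr, inner_sub_right]
    rw [this]
    exact MeasurableSet.iInter fun n =>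
      measurableSet_le ((hf _).sub measurable_const) measurable_const
  refine measurable_of_isOpen fun U hU => ?_
  have hU' : U = ⋃ p : {p : ℕ × ℚ // 0 ≤ p.2 ∧
      Metric.closedBall (TopologicalSpace.denseSeq E p.1) (p.2 : ℝ) ⊆ U},
      Metric.closedBall (TopologicalSpace.denseSeq E p.1.1) (p.1.2 : ℝ) := by
    apply Subset.antisymm
    · intro x hx
      obtain ⟨ε, hε, hεU⟩ := Metric.isOpen_iff.1 hU x hx
      -- The centre lies within `q` of `x`, so the ball of radius `q` around it stays within `2q <
      -- ε` of `x`.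
      obtain ⟨q, hq0, hq⟩ := exists_rat_btwn (half_pos hε)
      obtain ⟨n, hn⟩ := (TopologicalSpace.denseRange_denseSeq E).exists_dist_lt x hq0
      refine mem_iUnion.2 ⟨⟨(n, q), by exact_mod_cast hq0.le, fun y hy => hεU ?_⟩, hn.le⟩
      have h1 : dist y (TopologicalSpace.denseSeq E n) ≤ q := hy
      have h2 := dist_triangle_right y x (TopologicalSpace.denseSeq E n)
      rw [Metric.mem_ball]
      linarith
    · exact iUnion_subset fun p => p.2.2
  rw [hU', preimage_iUnion]
  exact MeasurableSet.iUnion fun p => hball _ _ (by exact_mod_cast p.2.1)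

end WeakMeasurability

/-! ### Growth of the semigroup and the covariance form of `Q_t` -/

section Semigroup

/-- Nothing is known about `S` at negative times; clamping them to `0` gives orbits continuous on
the whole line. -/
theorem IsC0Semigroup.continuous_clamp {H : Type*} [NormedAddCommGroup H] [NormedSpace ℝ H]
    {S : ℝ → H →L[ℝ] H} (hS : IsC0Semigroup S) (x : H) :
    Continuous fun s => S (max s 0) x :=
  (hS.continuous x).comp_continuous (by fun_prop) fun s => le_max_right s 0

theorem IsC0Semigroup.map_nat_mul {H : Type*} [NormedAddCommGroup H] [NormedSpace ℝ H]
    {S : ℝ → H →L[ℝ] H} (hS : IsC0Semigroup S) {T : ℝ} (hT : 0 ≤ T) (n : ℕ) :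
    S (n * T) = S T ^ n := by
  induction n with
  | zero => rw [Nat.cast_zero, zero_mul, pow_zero, hS.map_zero]; rfl
  | succ n ih =>
    rw [pow_succ, ← ih, Nat.cast_succ, add_mul, one_mul, hS.map_add _ _ (by positivity) hT]
    rfl

variable {K H : Type*} [NormedAddCommGroup K] [InnerProductSpace ℝ K] [CompleteSpace K]
  [NormedAddCommGroup H] [InnerProductSpace ℝ H] [CompleteSpace H]
  {S : ℝ → H →L[ℝ] H} {Q : K →L[ℝ] H}

theorem IsC0Semigroup.exists_norm_le (hS : IsC0Semigroup S) (T : ℝ) :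
    ∃ M : ℝ, 0 < M ∧ ∀ t ∈ Icc 0 T, ‖S t‖ ≤ M := by
  have h : ∀ x, ∃ C, ∀ t : Icc (0 : ℝ) T, ‖S t x‖ ≤ C := by
    intro x
    obtain ⟨C, hC⟩ := isCompact_Icc.exists_bound_of_continuousOn
      ((hS.continuous x).mono fun t ht => ht.1 : ContinuousOn _ (Icc 0 T))
    exact ⟨C, fun t => hC t t.2⟩
  obtain ⟨C, hC⟩ := banach_steinhaus h
  exact ⟨max C 1, by positivity, fun t ht => (hC ⟨t, ht⟩).trans (le_max_left _ _)⟩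

theorem IsC0Semigroup.exists_exponential_bound (hS : IsC0Semigroup S) {T : ℝ} (hT : 0 < T)
    (hnorm : ‖S T‖ < 1) :
    ∃ M ω : ℝ, 0 < M ∧ 0 < ω ∧ ∀ t, 0 ≤ t → ‖S t‖ ≤ M * Real.exp (-ω * t) := by
  obtain ⟨M, hM, hMT⟩ := hS.exists_norm_le T
  -- A number strictly above `‖S T‖` keeps the logarithm meaningful when `S T = 0`. The factor `c⁻¹`
  -- below pays for `t / T` exceeding its floor `n`.
  obtain ⟨c, hc, hc1⟩ := exists_between hnorm
  have hc0 : 0 < c := (norm_nonneg _).trans_lt hc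
  have hlog : Real.log c < 0 := Real.log_neg hc0 hc1
  refine ⟨M * c⁻¹, -Real.log c / T, by positivity, div_pos (neg_pos.2 hlog) hT, fun t ht => ?_⟩
  set n := ⌊t / T⌋₊
  have h1 : (n : ℝ) * T ≤ t := (le_div_iff₀ hT).1 (Nat.floor_le (by positivity))
  have h2 : t < (n + 1) * T := (div_lt_iff₀ hT).1 (Nat.lt_floor_add_one _)
  have hSt : S t = (S T ^ n) ∘L S (t - n * T) := by
    rw [← hS.map_nat_mul hT.le, ← hS.map_add _ _ (by positivity) (by linarith)]
    congr 1; ring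
  have hexp : c ^ n ≤ c⁻¹ * Real.exp (-(-Real.log c / T) * t) := by
    rw [← Real.exp_log hc0, ← Real.exp_nat_mul, ← Real.exp_neg, ← Real.exp_add, Real.exp_le_exp,
      Real.log_exp]
    have h3 : t / T ≤ n + 1 := (div_le_iff₀ hT).2 h2.le
    have : -(-Real.log c / T) * t = Real.log c * (t / T) := by field_simp
    rw [this]
    nlinarith
  calc ‖S t‖ ≤ ‖S T‖ ^ n * ‖S (t - n * T)‖ := by
        rw [hSt]
        refine (ContinuousLinearMap.opNorm_comp_le _ _).trans ?_
        gcongr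
        rcases Nat.eq_zero_or_pos n with h0 | h0
        · rw [h0, pow_zero, pow_zero]; exact ContinuousLinearMap.norm_id_le
        · exact norm_pow_le' _ h0
    _ ≤ c ^ n * M := by
        gcongr
        exact hMT _ ⟨by linarith, by linarith⟩
    _ ≤ (c⁻¹ * Real.exp (-(-Real.log c / T) * t)) * M := by gcongr
    _ = _ := by ring

/-- `Q* S(s)* h`, with negative times replaced by `0`. -/
noncomputable def adjointOrbit (S : ℝ → H →L[ℝ] H) (Q : K →L[ℝ] H) (h : H) (s : ℝ) : K :=
  ContinuousLinearMap.adjoint Q (ContinuousLinearMap.adjoint (S (max s 0)) h)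

/-- The quadratic form `⟨Q_t h, h⟩ = ∫₀ᵗ ‖Q* S(s)* h‖² ds`. -/
noncomputable def covForm (S : ℝ → H →L[ℝ] H) (Q : K →L[ℝ] H) (t : ℝ) (h : H) : ℝ :=
  ∫ s in (0 : ℝ)..t, ‖adjointOrbit S Q h s‖ ^ 2

/-- By duality the adjoint orbit is weakly continuous, and separability of `K` upgrades this to
strong measurability, which suffices for the integrals. -/
theorem IsC0Semigroup.stronglyMeasurable_adjointOrbit [SecondCountableTopology K]
    (hS : IsC0Semigroup S) (h : H) : StronglyMeasurable (adjointOrbit S Q h) := by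
  borelize K
  refine Measurable.stronglyMeasurable (measurable_of_forall_inner fun x => ?_)
  have : (fun s => inner ℝ x (adjointOrbit S Q h s)) = fun s => inner ℝ (S (max s 0) (Q x)) h := by
    ext s
    simp only [adjointOrbit, ContinuousLinearMap.adjoint_inner_right]
  rw [this]
  exact ((hS.continuous_clamp (Q x)).inner continuous_const).measurable

theorem IsC0Semigroup.exists_adjointOrbit_le (hS : IsC0Semigroup S) (Q : K →L[ℝ] H) (T : ℝ) :
    ∃ C : ℝ, 0 < C ∧ ∀ h, ∀ s ≤ T, ‖adjointOrbit S Q h s‖ ≤ C * ‖h‖ := by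
  obtain ⟨M, hM, hMT⟩ := hS.exists_norm_le (max T 0)
  refine ⟨(‖Q‖ + 1) * M, by positivity, fun h s hs => ?_⟩
  calc _ ≤ ‖ContinuousLinearMap.adjoint Q‖ * (‖ContinuousLinearMap.adjoint (S (max s 0))‖ * ‖h‖) :=
        (ContinuousLinearMap.le_opNorm _ _).trans (by gcongr; exact ContinuousLinearMap.le_opNorm _ _)
    _ ≤ _ := by
        rw [LinearIsometryEquiv.norm_map, LinearIsometryEquiv.norm_map, ← mul_assoc]
        gcongr
        · linarith
        · exact hMT _ ⟨le_max_right _ _, max_le_max_right _ hs⟩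

theorem covForm_nonneg {t : ℝ} (ht : 0 ≤ t) (h : H) : 0 ≤ covForm S Q t h :=
  intervalIntegral.integral_nonneg ht fun s _ => by positivity

variable [SecondCountableTopology K]

theorem IsC0Semigroup.intervalIntegrable_adjointOrbit (hS : IsC0Semigroup S) (h : H) (a b : ℝ) :
    IntervalIntegrable (fun s => ‖adjointOrbit S Q h s‖ ^ 2) volume a b := by
  obtain ⟨C, hC, hCT⟩ := hS.exists_adjointOrbit_le Q (max a b)
  have hc : IntervalIntegrable (fun _ : ℝ => (C * ‖h‖) ^ 2) volume a b :=
    intervalIntegrable_const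
  refine hc.mono_fun (((hS.stronglyMeasurable_adjointOrbit h).norm.pow 2).aestronglyMeasurable) ?_
  filter_upwards [ae_restrict_mem measurableSet_uIoc] with s hs
  rw [Real.norm_of_nonneg (by positivity), Real.norm_of_nonneg (by positivity)]
  gcongr
  exact hCT h s hs.2

theorem IsC0Semigroup.exists_covForm_le (hS : IsC0Semigroup S) (Q : K →L[ℝ] H) {t : ℝ}
    (ht : 0 ≤ t) : ∃ C : ℝ, ∀ h, covForm S Q t h ≤ C * ‖h‖ ^ 2 := by
  obtain ⟨C, hC, hCT⟩ := hS.exists_adjointOrbit_le Q t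
  refine ⟨t * C ^ 2, fun h => ?_⟩
  calc covForm S Q t h ≤ ∫ _ in (0 : ℝ)..t, (C * ‖h‖) ^ 2 :=
        intervalIntegral.integral_mono_on ht (hS.intervalIntegrable_adjointOrbit h _ _)
          intervalIntegrable_const fun s hs => by gcongr; exact hCT h s hs.2
    _ = _ := by rw [intervalIntegral.integral_const, smul_eq_mul]; ring

/-- `Q_{s+t} = Q_s + S(s) Q_t S(s)*`. -/
theorem IsC0Semigroup.covForm_add (hS : IsC0Semigroup S) {s t : ℝ} (hs : 0 ≤ s) (ht : 0 ≤ t)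
    (h : H) : covForm S Q (s + t) h
      = covForm S Q s h + covForm S Q t (ContinuousLinearMap.adjoint (S s) h) := by
  rw [covForm, ← intervalIntegral.integral_add_adjacent_intervals
    (hS.intervalIntegrable_adjointOrbit h 0 s) (hS.intervalIntegrable_adjointOrbit h s (s + t))]
  have hsub := intervalIntegral.integral_comp_add_left
    (fun r => ‖adjointOrbit S Q h r‖ ^ 2) (a := 0) (b := t) s
  rw [add_zero] at hsub
  rw [← hsub, covForm, covForm]
  congr 1
  refine intervalIntegral.integral_congr fun r hr => ?_
  rw [uIcc_of_le ht] at hr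
  have h1 : max (s + r) 0 = s + r := max_eq_left (add_nonneg hs hr.1)
  have h2 : max r 0 = r := max_eq_left hr.1
  simp only [adjointOrbit, h1, h2, hS.map_add s r hs hr.1, ContinuousLinearMap.adjoint_comp,
    ContinuousLinearMap.comp_apply]

theorem IsC0Semigroup.inner_covOp [SecondCountableTopology H] (hS : IsC0Semigroup S) {t : ℝ}
    (ht : 0 ≤ t) (h : H) : inner ℝ h (covOp S Q t h) = covForm S Q t h := by
  obtain ⟨C, hC, hCT⟩ := hS.exists_adjointOrbit_le Q t
  obtain ⟨M, hM, hMT⟩ := hS.exists_norm_le t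
  have hcongr : ∀ s ∈ uIcc 0 t, S s (Q (ContinuousLinearMap.adjoint Q
      (ContinuousLinearMap.adjoint (S s) h))) = S (max s 0) (Q (adjointOrbit S Q h s)) := by
    intro s hs
    rw [uIcc_of_le ht] at hs
    simp only [adjointOrbit, max_eq_left hs.1]
  have hmeas : StronglyMeasurable fun s => S (max s 0) (Q (adjointOrbit S Q h s)) := by
    borelize H
    refine Measurable.stronglyMeasurable (measurable_of_forall_inner fun x => ?_)
    have : (fun s => inner ℝ x (S (max s 0) (Q (adjointOrbit S Q h s))))
        = fun s => inner ℝ (adjointOrbit S Q x s) (adjointOrbit S Q h s) := by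
      ext s
      rw [← ContinuousLinearMap.adjoint_inner_left, ← ContinuousLinearMap.adjoint_inner_left]
      rfl
    rw [this]
    exact ((hS.stronglyMeasurable_adjointOrbit x).inner
      (hS.stronglyMeasurable_adjointOrbit h)).measurable
  -- Integrability is essential: otherwise the Bochner integral in `covOp` would take its default
  -- value `0`.
  have hint : IntervalIntegrable (fun s => S (max s 0) (Q (adjointOrbit S Q h s))) volume 0 t := by
    have hc : IntervalIntegrable (fun _ : ℝ => M * (‖Q‖ * (C * ‖h‖))) volume 0 t :=
      intervalIntegrable_const
    refine hc.mono_fun hmeas.aestronglyMeasurable ?_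
    filter_upwards [ae_restrict_mem measurableSet_uIoc] with s hs
    rw [uIoc_of_le ht] at hs
    rw [Real.norm_of_nonneg (by positivity), max_eq_left hs.1.le]
    refine (ContinuousLinearMap.le_opNorm _ _).trans ?_
    gcongr
    · exact hMT s ⟨hs.1.le, hs.2⟩
    · refine (ContinuousLinearMap.le_opNorm _ _).trans ?_
      gcongr
      exact hCT h s hs.2
  rw [covOp, intervalIntegral.integral_congr hcongr, covForm]
  have := (innerSL ℝ h).intervalIntegral_comp_comm hint
  simp only [innerSL_apply_apply] at this
  rw [← this]
  refine intervalIntegral.integral_congr fun s _ => ?_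
  rw [← ContinuousLinearMap.adjoint_inner_left, ← ContinuousLinearMap.adjoint_inner_left,
    ← real_inner_self_eq_norm_sq]
  rfl

/-- Self-adjointness gives `‖R h‖² = ⟨h, R² h⟩`. This lets the Gaussian estimates be carried out
with `R` alone. -/
theorem IsPositiveSqrt.norm_sq_eq_covForm [SecondCountableTopology H] (hS : IsC0Semigroup S)
    {T : ℝ} (hT : 0 ≤ T) {R : H →L[ℝ] H} (hR : IsPositiveSqrt R (covOp S Q T)) (h : H) :
    ‖R h‖ ^ 2 = covForm S Q T h := by
  rw [← hS.inner_covOp hT, ← hR.2, ← real_inner_self_eq_norm_sq]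
  exact hR.1.isSymmetric _ _

end Semigroup

/-! ### Wiener integrals of elementary integrands -/

section Elementary

variable {Ω K K' H : Type*} [MeasurableSpace Ω] {P : Measure Ω}
  [NormedAddCommGroup K] [InnerProductSpace ℝ K] [CompleteSpace K]
  [NormedAddCommGroup K'] [InnerProductSpace ℝ K'] [CompleteSpace K']
  [NormedAddCommGroup H] [InnerProductSpace ℝ H] [CompleteSpace H]
  {ι : K →L[ℝ] K'} {W : ℝ≥0 → Ω → K'}

/-- The overlap of two intervals is written in the form in which the covariance `s ∧ t` produces it
for a pair of increments, so that the two sides of the Itô isometry match term by term. -/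
theorem integral_indicator_Ioc_mul_indicator_Ioc {a b c d : ℝ} (ha : 0 ≤ a) (hab : a ≤ b)
    (hcd : c ≤ d) :
    ∫ r in Ioi (0 : ℝ), (Ioc a b).indicator (fun _ => (1 : ℝ)) r * (Ioc c d).indicator (fun _ => 1) r
      = min b d - min b c - (min a d - min a c) := by
  have h1 : ∀ r : ℝ, (Ioc a b).indicator (fun _ => (1 : ℝ)) r * (Ioc c d).indicator (fun _ => 1) r
      = (Ioc (max a c) (min b d)).indicator (fun _ => 1) r := by
    intro r
    rw [← Ioc_inter_Ioc, ← inter_indicator_mul, mul_one]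
  simp_rw [h1]
  rw [setIntegral_indicator measurableSet_Ioc, inter_eq_right.2, setIntegral_const,
    Real.volume_real_Ioc, smul_eq_mul, mul_one]
  · rcases le_total a c with h1 | h1 <;> rcases le_total b d with h2 | h2 <;>
      rcases le_total b c with h3 | h3 <;> rcases le_total a d with h4 | h4 <;>
      simp only [max_def, min_def] <;> split_ifs <;> linarith
  · exact fun r hr => lt_of_le_of_lt ha ((le_max_left _ _).trans_lt hr.1)

/-- The function `r ↦ (Φ(r) ι)* h` of an elementary integrand. -/
noncomputable def Elementary.adjointEval (Φ : Elementary K' H) (ι : K →L[ℝ] K') (h : H) (r : ℝ) : K :=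
  ContinuousLinearMap.adjoint (Φ.eval ι r) h

theorem Elementary.adjointEval_eq (Φ : Elementary K' H) (ι : K →L[ℝ] K') (h : H) (r : ℝ) :
    Φ.adjointEval ι h r = ∑ i, (Ioc (Φ.left i : ℝ) (Φ.right i : ℝ)).indicator (fun _ => (1 : ℝ)) r •
      ContinuousLinearMap.adjoint ι (ContinuousLinearMap.adjoint (Φ.B i) h) := by
  simp only [adjointEval, eval, map_sum, sum_apply]
  refine Finset.sum_congr rfl fun i _ => ?_
  by_cases hr : r ∈ Ioc (Φ.left i : ℝ) (Φ.right i : ℝ)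
  · simp only [indicator_of_mem hr, ContinuousLinearMap.adjoint_comp, one_smul,
      ContinuousLinearMap.comp_apply]
  · simp only [indicator_of_notMem hr, map_zero, zero_apply, zero_smul]

theorem Elementary.memLp_adjointEval (Φ : Elementary K' H) (ι : K →L[ℝ] K') (h : H) :
    MemLp (Φ.adjointEval ι h) 2 (volume.restrict (Ioi (0 : ℝ))) := by
  rw [funext (Φ.adjointEval_eq ι h)]
  refine memLp_finsetSum _ fun i _ => ?_
  simp_rw [← indicator_smul_const_apply, one_smul]
  refine memLp_indicator_const 2 measurableSet_Ioc _ (Or.inr ?_)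
  refine ((Measure.restrict_apply_le _ _).trans_lt ?_).ne
  simp

theorem Elementary.integral_norm_sq_adjointEval (Φ : Elementary K' H) (ι : K →L[ℝ] K') (h : H) :
    ∫ r in Ioi (0 : ℝ), ‖Φ.adjointEval ι h r‖ ^ 2
      = ∑ i, ∑ j, (min (Φ.right i : ℝ) (Φ.right j) - min (Φ.right i : ℝ) (Φ.left j)
        - (min (Φ.left i : ℝ) (Φ.right j) - min (Φ.left i : ℝ) (Φ.left j))) *
        inner ℝ (ContinuousLinearMap.adjoint ι (ContinuousLinearMap.adjoint (Φ.B i) h))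
          (ContinuousLinearMap.adjoint ι (ContinuousLinearMap.adjoint (Φ.B j) h)) := by
  simp_rw [← real_inner_self_eq_norm_sq, Φ.adjointEval_eq, sum_inner, inner_sum,
    real_inner_smul_left, real_inner_smul_right, ← mul_assoc]
  have hint : ∀ i j, Integrable (fun r => (Ioc (Φ.left i : ℝ) (Φ.right i : ℝ)).indicator
      (fun _ => (1 : ℝ)) r * (Ioc (Φ.left j : ℝ) (Φ.right j : ℝ)).indicator (fun _ => (1 : ℝ)) r)
      (volume.restrict (Ioi (0 : ℝ))) := by
    intro i j
    simp_rw [← inter_indicator_mul, mul_one]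
    refine Integrable.mono_measure ?_ Measure.restrict_le_self
    refine (integrable_indicator_iff (measurableSet_Ioc.inter measurableSet_Ioc)).2
      (integrableOn_const ?_)
    refine ((measure_mono inter_subset_left).trans_lt ?_).ne
    simp
  rw [integral_finsetSum _ fun i _ => integrable_finsetSum _ fun j _ => (hint i j).mul_const _]
  refine Finset.sum_congr rfl fun i _ => ?_
  rw [integral_finsetSum _ fun j _ => (hint i j).mul_const _]
  refine Finset.sum_congr rfl fun j _ => ?_
  rw [integral_mul_const]
  congr 1
  exact integral_indicator_Ioc_mul_indicator_Ioc (Φ.left i).2 (Φ.left_le_right i)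
    (Φ.left_le_right j)

theorem Elementary.inner_integral {Ω : Type*} {W : ℝ≥0 → Ω → K'} (Φ : Elementary K' H) (h : H) (ω : Ω) :
    inner ℝ h (Φ.integral W ω) = ∑ i, inner ℝ (ContinuousLinearMap.adjoint (Φ.B i) h)
      (W (Φ.right i) ω - W (Φ.left i) ω) := by
  simp only [Elementary.integral, inner_sum, ContinuousLinearMap.adjoint_inner_left]

variable [MeasurableSpace K'] [SecondCountableTopology K'] [BorelSpace K']

theorem Elementary.hasGaussianLaw_inner_integral {H : Type*} [NormedAddCommGroup H]
    [InnerProductSpace ℝ H] (hW : IsCylindricalWiener P ι W)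
    (Φ : Elementary K' H) (h : H) :
    HasGaussianLaw (fun ω => inner ℝ h (Φ.integral W ω)) P := by
  classical
  -- The scalar integral is a linear image of `W` at finitely many times; regarding it as a process
  -- with one time transfers Gaussianity.
  have : IsGaussianProcess (fun (_ : Unit) ω => inner ℝ h (Φ.integral W ω)) P := by
    refine hW.gaussian.of_isGaussianProcess fun _ =>
      ⟨Finset.univ.image Φ.left ∪ Finset.univ.image Φ.right,
      ∑ i, (innerSL ℝ h ∘L Φ.B i) ∘L
        (ContinuousLinearMap.proj (R := ℝ) (φ := fun _ : {x // x ∈ Finset.univ.image Φ.left ∪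
            Finset.univ.image Φ.right} => K') ⟨Φ.right i, by simp⟩
          - ContinuousLinearMap.proj ⟨Φ.left i, by simp⟩), fun ω => ?_⟩
    simp [Elementary.integral, inner_sum, inner_sub_right, Finset.restrict]
  exact this.hasGaussianLaw_eval ()

theorem IsCylindricalWiener.memLp (hW : IsCylindricalWiener P ι W) (t : ℝ≥0) : MemLp (W t) 2 P :=
  (hW.gaussian.hasGaussianLaw_eval t).memLp_two

theorem IsCylindricalWiener.covariance_sub (hW : IsCylindricalWiener P ι W) (a b c d : ℝ≥0)
    (h k : K') : ∫ ω, inner ℝ h (W b ω - W a ω) * inner ℝ k (W d ω - W c ω) ∂P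
      = (min (b : ℝ) d - min (b : ℝ) c - (min (a : ℝ) d - min (a : ℝ) c)) *
        inner ℝ (ContinuousLinearMap.adjoint ι h) (ContinuousLinearMap.adjoint ι k) := by
  have hint : ∀ s t : ℝ≥0, Integrable (fun ω => inner ℝ h (W s ω) * inner ℝ k (W t ω)) P :=
    fun s t => ((hW.memLp s).const_inner h).integrable_mul ((hW.memLp t).const_inner k)
  have hcov : ∀ s t : ℝ≥0, ∫ ω, inner ℝ h (W s ω) * inner ℝ k (W t ω) ∂P = min (s : ℝ) t *
      inner ℝ (ContinuousLinearMap.adjoint ι h) (ContinuousLinearMap.adjoint ι k) := by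
    intro s t
    rw [← NNReal.coe_min, ← hW.covariance]
    simp_rw [real_inner_comm k]
  have heq : ∀ ω, inner ℝ h (W b ω - W a ω) * inner ℝ k (W d ω - W c ω)
      = (inner ℝ h (W b ω) * inner ℝ k (W d ω) - inner ℝ h (W b ω) * inner ℝ k (W c ω))
        - (inner ℝ h (W a ω) * inner ℝ k (W d ω) - inner ℝ h (W a ω) * inner ℝ k (W c ω)) := by
    intro ω
    rw [inner_sub_right, inner_sub_right]
    ring
  simp_rw [heq]
  have hsub : ∀ a c d : ℝ≥0, Integrable (fun ω => inner ℝ h (W a ω) * inner ℝ k (W d ω)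
      - inner ℝ h (W a ω) * inner ℝ k (W c ω)) P := fun a c d => (hint a d).sub (hint a c)
  rw [integral_sub (hsub b c d) (hsub a c d),
    integral_sub (hint b d) (hint b c), integral_sub (hint a d) (hint a c)]
  simp_rw [hcov]
  ring

theorem Elementary.integral_inner_integral (hW : IsCylindricalWiener P ι W)
    (Φ : Elementary K' H) (h : H) : ∫ ω, inner ℝ h (Φ.integral W ω) ∂P = 0 := by
  have := hW.gaussian.isProbabilityMeasure
  simp_rw [Φ.inner_integral, inner_sub_right]
  have hint : ∀ (k : K') (t : ℝ≥0), Integrable (fun ω => inner ℝ k (W t ω)) P :=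
    fun k t => ((hW.memLp t).const_inner k).integrable one_le_two
  have hsub : ∀ (k : K') (s t : ℝ≥0),
      Integrable (fun ω => inner ℝ k (W t ω) - inner ℝ k (W s ω)) P :=
    fun k s t => (hint k t).sub (hint k s)
  rw [integral_finsetSum _ fun i _ => hsub _ _ _]
  refine Finset.sum_eq_zero fun i _ => ?_
  rw [integral_sub (hint _ _) (hint _ _), hW.centred, hW.centred, sub_zero]

/-- The Itô isometry, tested against a vector. -/
theorem Elementary.integral_inner_integral_sq (hW : IsCylindricalWiener P ι W)
    (Φ : Elementary K' H) (h : H) : ∫ ω, inner ℝ h (Φ.integral W ω) ^ 2 ∂P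
      = ∫ r in Ioi (0 : ℝ), ‖Φ.adjointEval ι h r‖ ^ 2 := by
  simp_rw [Φ.inner_integral, sq, Finset.sum_mul_sum, ← sq]
  have hint : ∀ (k l : K') (a b c d : ℝ≥0),
      Integrable (fun ω => inner ℝ k (W b ω - W a ω) * inner ℝ l (W d ω - W c ω)) P :=
    fun k l a b c d => MemLp.integrable_mul (((hW.memLp b).sub (hW.memLp a)).const_inner k)
      (((hW.memLp d).sub (hW.memLp c)).const_inner l)
  rw [integral_finsetSum _ fun i _ => integrable_finsetSum _ fun j _ => hint _ _ _ _ _ _,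
    Φ.integral_norm_sq_adjointEval]
  refine Finset.sum_congr rfl fun i _ => ?_
  rw [integral_finsetSum _ fun j _ => hint _ _ _ _ _ _]
  exact Finset.sum_congr rfl fun j _ => hW.covariance_sub _ _ _ _ _ _

/-- A centred Gaussian scalar is determined by its variance, which the Itô isometry supplies; the
formula is its characteristic function at `1`. -/
theorem Elementary.integral_exp_inner_integral (hW : IsCylindricalWiener P ι W)
    (Φ : Elementary K' H) (h : H) :
    ∫ ω, Complex.exp (inner ℝ h (Φ.integral W ω) * Complex.I) ∂P
      = Complex.exp (-((∫ r in Ioi (0 : ℝ), ‖Φ.adjointEval ι h r‖ ^ 2 : ℝ) : ℂ) / 2) := by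
  have := hW.gaussian.isProbabilityMeasure
  have hg := Φ.hasGaussianLaw_inner_integral hW h
  have h1 := congrArg (fun μ => charFun μ 1) hg.map_eq_gaussianReal
  simp only [charFun_gaussianReal] at h1
  rw [charFun_apply_real, integral_map hg.aemeasurable (by fun_prop)] at h1
  rw [Φ.integral_inner_integral hW, variance_of_integral_eq_zero hg.aemeasurable
    (Φ.integral_inner_integral hW h), Φ.integral_inner_integral_sq hW] at h1
  rw [Real.coe_toNNReal _ (integral_nonneg fun _ => by positivity)] at h1
  simp only [Complex.ofReal_one, one_mul, Complex.ofReal_zero, zero_mul, mul_one, one_pow, zero_sub,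
    mul_zero] at h1
  rw [h1, neg_div]

end Elementary

theorem tendsto_integral_norm_sq_of_tendsto_eLpNorm {α E : Type*} [MeasurableSpace α]
    {μ : Measure α} [NormedAddCommGroup E] {f : ℕ → α → E} {g : α → E}
    (hf : ∀ n, MemLp (f n) 2 μ) (hg : MemLp g 2 μ)
    (h : Tendsto (fun n => eLpNorm (f n - g) 2 μ) atTop (𝓝 0)) :
    Tendsto (fun n => ∫ a, ‖f n a‖ ^ 2 ∂μ) atTop (𝓝 (∫ a, ‖g a‖ ^ 2 ∂μ)) := by
  have key : ∀ u : α → E, (hu : MemLp u 2 μ) → ∫ a, ‖u a‖ ^ 2 ∂μ = ‖hu.toLp u‖ ^ 2 := by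
    intro u hu
    have h0 : 0 ≤ ∫ a, ‖u a‖ ^ 2 ∂μ := integral_nonneg fun _ => by positivity
    rw [Lp.norm_toLp, hu.eLpNorm_eq_integral_rpow_norm two_ne_zero ENNReal.ofNat_ne_top,
      ENNReal.toReal_ofReal (by positivity)]
    simp only [ENNReal.toReal_ofNat, Real.rpow_ofNat]
    rw [← Real.rpow_natCast, ← Real.rpow_mul h0]
    norm_num
  simp_rw [key _ hg, fun n => key _ (hf n)]
  exact (((Lp.tendsto_Lp_iff_tendsto_eLpNorm'' _ hf _ hg).2 h).norm).pow 2

/-- Parseval for `A* h` followed by Cauchy-Schwarz in each term. It turns Hilbert-Schmidt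
convergence of integrands into `L²` convergence of their adjoints applied to `h`. -/
theorem enorm_adjoint_sq_le_hsNormSq {K H : Type*} [NormedAddCommGroup K] [InnerProductSpace ℝ K]
    [CompleteSpace K] [NormedAddCommGroup H] [InnerProductSpace ℝ H] [CompleteSpace H]
    (A : K →L[ℝ] H) (h : H) :
    ‖ContinuousLinearMap.adjoint A h‖ₑ ^ 2 ≤ ‖h‖ₑ ^ 2 * hsNormSq A := by
  obtain ⟨b, hb⟩ := (exists_hilbertBasis ℝ K).choose_spec
  have h1 := b.hasSum_inner_mul_inner (ContinuousLinearMap.adjoint A h)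
    (ContinuousLinearMap.adjoint A h)
  rw [real_inner_self_eq_norm_sq] at h1
  have h2 : ∀ i, inner ℝ (ContinuousLinearMap.adjoint A h) (b i)
      * inner ℝ (b i) (ContinuousLinearMap.adjoint A h) = inner ℝ h (A (b i)) ^ 2 := by
    intro i
    rw [real_inner_comm, ContinuousLinearMap.adjoint_inner_right, real_inner_comm, sq]
  simp_rw [h2] at h1
  rw [← ofReal_norm, ← ENNReal.ofReal_pow (norm_nonneg _), ← h1.tsum_eq,
    ENNReal.ofReal_tsum_of_nonneg (fun _ => by positivity) h1.summable, hsNormSq,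
    ← ENNReal.tsum_mul_left]
  refine ENNReal.tsum_le_tsum fun i => ?_
  rw [← ofReal_norm, ← ofReal_norm, ← ENNReal.ofReal_pow (norm_nonneg _),
    ← ENNReal.ofReal_pow (norm_nonneg _), ← ENNReal.ofReal_mul (by positivity), ← mul_pow, ← hb]
  refine ENNReal.ofReal_le_ofReal ?_
  rw [← sq_abs]
  gcongr
  exact abs_real_inner_le_norm _ _

/-! ### The Gaussian law of the stochastic convolution -/

section Law

set_option linter.unusedSectionVars false

variable {Ω K K' H : Type*} [MeasurableSpace Ω] {P : Measure Ω}
  [NormedAddCommGroup K] [InnerProductSpace ℝ K] [CompleteSpace K] [SecondCountableTopology K]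
  [NormedAddCommGroup K'] [InnerProductSpace ℝ K'] [CompleteSpace K'] [MeasurableSpace K']
  [SecondCountableTopology K'] [BorelSpace K']
  [NormedAddCommGroup H] [InnerProductSpace ℝ H] [CompleteSpace H]
  [SecondCountableTopology H] [MeasurableSpace H] [BorelSpace H]
  {ι : K →L[ℝ] K'} {W : ℝ≥0 → Ω → K'} {S : ℝ → H →L[ℝ] H} {Q : K →L[ℝ] H}

theorem adjoint_convIntegrand (t : ℝ) (h : H) (r : ℝ) :
    ContinuousLinearMap.adjoint (convIntegrand S Q t r) h
      = (Ioc 0 t).indicator (fun s => adjointOrbit S Q h (t - s)) r := by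
  rw [convIntegrand]
  by_cases hr : r ∈ Ioc 0 t
  · rw [indicator_of_mem hr, indicator_of_mem hr, adjointOrbit, max_eq_left (by linarith [hr.2]),
      ContinuousLinearMap.adjoint_comp, ContinuousLinearMap.comp_apply]
  · rw [indicator_of_notMem hr, indicator_of_notMem hr, map_zero, zero_apply]

theorem integral_norm_sq_adjoint_convIntegrand {t : ℝ} (ht : 0 ≤ t) (h : H) :
    ∫ r in Ioi (0 : ℝ), ‖ContinuousLinearMap.adjoint (convIntegrand S Q t r) h‖ ^ 2
      = covForm S Q t h := by
  have h1 : ∀ r, ‖ContinuousLinearMap.adjoint (convIntegrand S Q t r) h‖ ^ 2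
      = (Ioc 0 t).indicator (fun s => ‖adjointOrbit S Q h (t - s)‖ ^ 2) r := by
    intro r
    rw [adjoint_convIntegrand, norm_indicator_eq_indicator_norm]
    by_cases hr : r ∈ Ioc 0 t
    · rw [indicator_of_mem hr, indicator_of_mem hr]
    · rw [indicator_of_notMem hr, indicator_of_notMem hr, zero_pow two_ne_zero]
  simp_rw [h1]
  rw [setIntegral_indicator measurableSet_Ioc, inter_eq_right.2 fun r hr => hr.1,
    ← intervalIntegral.integral_of_le ht,
    intervalIntegral.integral_comp_sub_left (fun s => ‖adjointOrbit S Q h s‖ ^ 2), sub_self,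
    sub_zero, covForm]

theorem IsC0Semigroup.memLp_adjoint_convIntegrand (hS : IsC0Semigroup S) (t : ℝ) (h : H) :
    MemLp (fun r => ContinuousLinearMap.adjoint (convIntegrand S Q t r) h) 2
      (volume.restrict (Ioi (0 : ℝ))) := by
  obtain ⟨C, hC, hCt⟩ := hS.exists_adjointOrbit_le Q t
  have hm : StronglyMeasurable
      (fun r => ContinuousLinearMap.adjoint (convIntegrand S Q t r) h) := by
    simp_rw [adjoint_convIntegrand]
    exact ((hS.stronglyMeasurable_adjointOrbit h).comp_measurable
      (measurable_const.sub measurable_id)).indicator measurableSet_Ioc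
  have hc : MemLp ((Ioc 0 t).indicator (fun _ => C * ‖h‖)) 2 (volume.restrict (Ioi (0 : ℝ))) := by
    refine memLp_indicator_const 2 measurableSet_Ioc _ (Or.inr ?_)
    refine ((Measure.restrict_apply_le _ _).trans_lt ?_).ne
    simp
  refine hc.mono' hm.aestronglyMeasurable (ae_of_all _ fun r => ?_)
  rw [adjoint_convIntegrand, norm_indicator_eq_indicator_norm]
  by_cases hr : r ∈ Ioc 0 t
  · rw [indicator_of_mem hr, indicator_of_mem hr]
    exact hCt h _ (by linarith [hr.1])
  · rw [indicator_of_notMem hr, indicator_of_notMem hr]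

theorem Elementary.memLp_integral (hW : IsCylindricalWiener P ι W) (Φ : Elementary K' H) :
    MemLp (Φ.integral W) 2 P :=
  memLp_finsetSum _ fun i _ =>
    (Φ.B i).comp_memLp' ((hW.memLp (Φ.right i)).sub (hW.memLp (Φ.left i)))

theorem IsStochIntegral.memLp (hW : IsCylindricalWiener P ι W) {Φ : ℝ → K →L[ℝ] H} {Z : Ω → H}
    (hZ : IsStochIntegral P ι W Φ Z) : MemLp Z 2 P := by
  obtain ⟨hm, Ψ, -, hΨ⟩ := hZ
  obtain ⟨n, hn⟩ := (hΨ.eventually (gt_mem_nhds ENNReal.zero_lt_top)).exists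
  have h1 : MemLp (fun ω => (Ψ n).integral W ω - Z ω) 2 P :=
    ⟨((Ψ n).memLp_integral hW).1.sub hm.aestronglyMeasurable, hn⟩
  convert! ((Ψ n).memLp_integral hW).sub h1 using 1
  ext ω
  simp

/-- `∫₀ᵗ S(t - s) Q dW(s)` has the law `N(0, Q_t)`. -/
theorem IsStochIntegral.charFun_map (hW : IsCylindricalWiener P ι W) (hS : IsC0Semigroup S) {t : ℝ}
    (ht : 0 ≤ t) {Z : Ω → H} (hZ : IsStochIntegral P ι W (convIntegrand S Q t) Z) (h : H) :
    charFun (P.map Z) h = Complex.exp (-(covForm S Q t h : ℂ) / 2) := by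
  have := hW.gaussian.isProbabilityMeasure
  obtain ⟨hm, Ψ, hΨ1, hΨ2⟩ := hZ
  have hcov : Tendsto (fun n => ∫ r in Ioi (0 : ℝ), ‖(Ψ n).adjointEval ι h r‖ ^ 2) atTop
      (𝓝 (covForm S Q t h)) := by
    rw [← integral_norm_sq_adjoint_convIntegrand ht]
    refine tendsto_integral_norm_sq_of_tendsto_eLpNorm (fun n => (Ψ n).memLp_adjointEval ι h)
      (hS.memLp_adjoint_convIntegrand t h) ?_
    have h1 : Tendsto (fun n => ‖h‖ₑ ^ 2 * ∫⁻ r in Ioi (0 : ℝ),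
        hsNormSq ((Ψ n).eval ι r - convIntegrand S Q t r)) atTop (𝓝 0) := by
      have := ENNReal.Tendsto.const_mul hΨ1 (Or.inr (ENNReal.pow_ne_top enorm_ne_top :
        ‖h‖ₑ ^ 2 ≠ ∞))
      rwa [mul_zero] at this
    have h2 := ((ENNReal.continuous_rpow_const (y := 1 / 2)).tendsto 0).comp h1
    rw [ENNReal.zero_rpow_of_pos (by norm_num)] at h2
    refine tendsto_of_tendsto_of_tendsto_of_le_of_le tendsto_const_nhds h2 (fun _ => zero_le)
      fun n => ?_
    rw [eLpNorm_eq_lintegral_rpow_enorm_toReal two_ne_zero ENNReal.ofNat_ne_top]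
    simp only [ENNReal.toReal_ofNat, Function.comp_apply]
    gcongr
    rw [← lintegral_const_mul' _ _ (ENNReal.pow_ne_top enorm_ne_top)]
    refine lintegral_mono fun r => ?_
    rw [ENNReal.rpow_ofNat]
    refine le_trans (le_of_eq ?_) (enorm_adjoint_sq_le_hsNormSq _ h)
    rw [map_sub]
    rfl
  -- An almost surely convergent subsequence suffices, since the bounded exponentials then converge
  -- by dominated convergence.
  obtain ⟨φ, hφ, hφZ⟩ := (tendstoInMeasure_of_tendsto_eLpNorm two_ne_zero
    (fun n => ((Ψ n).memLp_integral hW).1) hm.aestronglyMeasurable hΨ2).exists_seq_tendsto_ae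
  have hlim1 : Tendsto (fun n => ∫ ω, Complex.exp (inner ℝ h ((Ψ (φ n)).integral W ω) * Complex.I) ∂P)
      atTop (𝓝 (∫ ω, Complex.exp (inner ℝ h (Z ω) * Complex.I) ∂P)) := by
    refine tendsto_integral_of_dominated_convergence (fun _ => 1) (fun n => ?_)
      (integrable_const _) (fun n => ae_of_all _ fun ω => ?_) ?_
    · have := (((Ψ (φ n)).memLp_integral hW).1.const_inner (𝕜 := ℝ) (c := h))
      exact (by fun_prop : Continuous fun x : ℝ =>
        Complex.exp (x * Complex.I)).comp_aestronglyMeasurable this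
    · rw [Complex.norm_exp_ofReal_mul_I]
    · filter_upwards [hφZ] with ω hω
      exact ((by fun_prop : Continuous fun x : H =>
        Complex.exp ((inner ℝ h x : ℝ) * Complex.I)).tendsto _).comp hω
  have hlim2 : Tendsto (fun n => ∫ ω, Complex.exp (inner ℝ h ((Ψ (φ n)).integral W ω) * Complex.I) ∂P)
      atTop (𝓝 (Complex.exp (-(covForm S Q t h : ℂ) / 2))) := by
    simp_rw [Elementary.integral_exp_inner_integral hW]
    exact ((by fun_prop : Continuous fun x : ℝ => Complex.exp (-(x : ℂ) / 2)).tendsto _).comp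
      (hcov.comp hφ.tendsto_atTop)
  rw [charFun_apply, integral_map hm.aemeasurable (by fun_prop)]
  simp_rw [real_inner_comm h]
  exact tendsto_nhds_unique hlim1 hlim2

/-- The law of the stochastic convolution at time `t`. -/
noncomputable def convLaw (P : Measure Ω) (ι : K →L[ℝ] K') (W : ℝ≥0 → Ω → K')
    (S : ℝ → H →L[ℝ] H) (Q : K →L[ℝ] H) (t : ℝ) : Measure H :=
  P.map (stochConv P ι W S Q t)

instance [IsProbabilityMeasure P] (t : ℝ) : IsProbabilityMeasure (convLaw P ι W S Q t) :=
  Measure.isProbabilityMeasure_map (measurable_stochConv P ι W S Q t).aemeasurable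

/-- Any mild solution provides a stochastic integral, so the default value `0` of `stochConv` is not
used. -/
theorem isStochIntegral_stochConv
    (hsol : ∀ x₀ : H, ∃ x : ℝ → Ω → H, IsMildSolution P ι W S Q x₀ x) {t : ℝ} (ht : 0 ≤ t) :
    IsStochIntegral P ι W (convIntegrand S Q t) (stochConv P ι W S Q t) := by
  obtain ⟨x, hx⟩ := hsol 0
  obtain ⟨-, Z, hZ, -⟩ := hx t ht
  have h : ∃ Z, IsStochIntegral P ι W (convIntegrand S Q t) Z := ⟨Z, hZ⟩
  rw [stochConv, dif_pos h]
  exact h.choose_spec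

/-- The equation is linear with additive noise: the noise term has the same law for every starting
point, so mixing over `ν` is a convolution. -/
theorem evolve_eq_conv [IsProbabilityMeasure P] (t : ℝ) (ν : Measure H) [SFinite ν] :
    evolve P ι W S Q t ν = (ν.map (S t)) ∗ convLaw P ι W S Q t := by
  have hm := measurable_stochConv P ι W S Q t
  ext A hA
  rw [evolve, Measure.bind_apply hA (Kernel.aemeasurable _), ← lintegral_indicator_one hA,
    Measure.lintegral_conv (measurable_one.indicator hA),
    lintegral_map ?_ (S t).continuous.measurable]
  · refine lintegral_congr fun x => ?_
    rw [convLaw, lintegral_map (by measurability) hm, ← lintegral_indicator_one hA]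
    exact lintegral_map (measurable_one.indicator hA) (measurable_const.add hm)
  · exact Measurable.lintegral_prod_right' (f := fun p : H × H => A.indicator 1 (p.1 + p.2))
      ((measurable_one.indicator hA).comp measurable_add)

end Law

/-! ### Total variation bounds -/

section TotalVariation

/-- The integrals of Borel functions with values in `[-1, 1]` against `μ` and `ν` differ by at most
`c`. -/
def TVClose {X : Type*} [MeasurableSpace X] (μ ν : Measure X) (c : ℝ) : Prop :=
  ∀ φ : X → ℝ, Measurable φ → (∀ x, |φ x| ≤ 1) → |∫ x, φ x ∂μ - ∫ x, φ x ∂ν| ≤ c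

variable {X Y : Type*} [MeasurableSpace X] [MeasurableSpace Y]

theorem integrable_of_abs_le_one {μ : Measure X} [IsFiniteMeasure μ] {φ : X → ℝ}
    (hφ : Measurable φ) (h1 : ∀ x, |φ x| ≤ 1) : Integrable φ μ :=
  Integrable.of_bound hφ.aestronglyMeasurable 1 (ae_of_all _ h1)

theorem abs_integral_le_one {μ : Measure X} [IsProbabilityMeasure μ] {φ : X → ℝ}
    (h1 : ∀ x, |φ x| ≤ 1) : |∫ x, φ x ∂μ| ≤ 1 := by
  have := norm_integral_le_of_norm_le_const (μ := μ) (f := φ) (C := 1) (ae_of_all _ h1)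
  simpa using this

theorem tvClose_two (μ ν : Measure X) [IsProbabilityMeasure μ] [IsProbabilityMeasure ν] :
    TVClose μ ν 2 := by
  intro φ _ h1
  have h2 := abs_le.1 (abs_integral_le_one (μ := μ) h1)
  have h3 := abs_le.1 (abs_integral_le_one (μ := ν) h1)
  exact abs_le.2 ⟨by linarith, by linarith⟩

theorem TVClose.mono {μ ν : Measure X} {c d : ℝ} (h : TVClose μ ν c) (hcd : c ≤ d) :
    TVClose μ ν d := fun φ hφ h1 => (h φ hφ h1).trans hcd

theorem TVClose.tvDist_le {μ ν : Measure X} {c : ℝ} (h : TVClose μ ν c) :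
    tvDist μ ν ≤ ENNReal.ofReal c :=
  iSup_le fun φ => iSup_le fun hφ => iSup_le fun h1 =>
    ENNReal.ofReal_le_ofReal ((le_abs_self _).trans (h φ hφ h1))

theorem TVClose.map {μ ν : Measure X} {c : ℝ} (h : TVClose μ ν c) {f : X → Y} (hf : Measurable f) :
    TVClose (μ.map f) (ν.map f) c := by
  intro φ hφ h1
  rw [integral_map hf.aemeasurable hφ.aestronglyMeasurable,
    integral_map hf.aemeasurable hφ.aestronglyMeasurable]
  exact h _ (hφ.comp hf) fun x => h1 _

/-- Each translate of a test function is again a test function, and averaging over `ρ` preserves the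
bound. -/
theorem TVClose.conv_left [AddCommMonoid X] [MeasurableAdd₂ X] {μ ν : Measure X}
    [IsProbabilityMeasure μ] [IsProbabilityMeasure ν] {c : ℝ} (h : TVClose μ ν c) (ρ : Measure X)
    [IsProbabilityMeasure ρ] : TVClose (ρ ∗ μ) (ρ ∗ ν) c := by
  intro φ hφ h1
  have hm : ∀ κ : Measure X, IsProbabilityMeasure κ →
      Integrable (fun x => ∫ y, φ (x + y) ∂κ) ρ := fun κ _ =>
    Integrable.of_bound (StronglyMeasurable.integral_prod_right'
      (f := fun p : X × X => φ (p.1 + p.2))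
      (hφ.comp measurable_add).stronglyMeasurable).aestronglyMeasurable 1
      (ae_of_all _ fun x => abs_integral_le_one fun y => h1 _)
  rw [integral_conv (integrable_of_abs_le_one hφ h1), integral_conv (integrable_of_abs_le_one hφ h1),
    ← integral_sub (hm μ inferInstance) (hm ν inferInstance)]
  have := norm_integral_le_of_norm_le_const (μ := ρ) (C := c)
    (f := fun x => ∫ y, φ (x + y) ∂μ - ∫ y, φ (x + y) ∂ν) (ae_of_all _ fun x =>
    h (fun y => φ (x + y)) (hφ.comp (measurable_const_add x)) fun y => h1 _)
  simpa using this

/-- It is enough to test the total variation distance with continuous functions. -/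
theorem tvClose_of_continuous [PseudoMetricSpace X] [BorelSpace X] {μ ν : Measure X}
    [IsProbabilityMeasure μ] [IsProbabilityMeasure ν] {c : ℝ}
    (h : ∀ φ : X → ℝ, Continuous φ → (∀ x, |φ x| ≤ 1) → |∫ x, φ x ∂μ - ∫ x, φ x ∂ν| ≤ c) :
    TVClose μ ν c := by
  intro φ hφ h1
  refine le_of_forall_pos_le_add fun ε hε => ?_
  -- Approximating in `L¹(μ + ν)` makes a single `g` work for both measures. Truncating `g` to `[-1,
  -- 1]` brings it no further from `φ`, because truncation is 1-Lipschitz and fixes the values of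
  -- `φ`.
  obtain ⟨g, hg, hgi⟩ := (integrable_of_abs_le_one (μ := μ + ν)
    hφ h1).exists_boundedContinuous_integral_sub_le hε
  set ψ : X → ℝ := fun x => max (-1) (min 1 (g x)) with hψ
  have hψc : Continuous ψ := by fun_prop
  have hψ1 : ∀ x, |ψ x| ≤ 1 := fun x =>
    abs_le.2 ⟨le_max_left _ _, max_le (by norm_num) (min_le_left _ _)⟩
  have hle : ∀ x, |φ x - ψ x| ≤ ‖φ x - g x‖ := by
    intro x
    have h2 := abs_le.1 (h1 x)
    have h3 : φ x = max (-1) (min 1 (φ x)) := by rw [min_eq_right h2.2, max_eq_right h2.1]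
    rw [Real.norm_eq_abs]
    calc |φ x - ψ x| = |max (-1) (min 1 (φ x)) - max (-1) (min 1 (g x))| := by rw [← h3]
      _ ≤ |min 1 (φ x) - min 1 (g x)| := by
          rw [max_comm, max_comm (-1 : ℝ)]; exact abs_max_sub_max_le_abs _ _ _
      _ ≤ _ := (abs_min_sub_min_le_max _ _ _ _).trans (by simp)
  have hi : ∀ κ : Measure X, IsProbabilityMeasure κ → Integrable φ κ ∧ Integrable ψ κ :=
    fun κ _ => ⟨integrable_of_abs_le_one hφ h1, integrable_of_abs_le_one hψc.measurable hψ1⟩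
  have hb : ∀ κ : Measure X, IsProbabilityMeasure κ → Integrable (fun x => ‖φ x - g x‖) κ →
      |∫ x, φ x ∂κ - ∫ x, ψ x ∂κ| ≤ ∫ x, ‖φ x - g x‖ ∂κ := by
    intro κ hκ hκi
    rw [← integral_sub (hi κ hκ).1 (hi κ hκ).2]
    refine abs_integral_le_integral_abs.trans ?_
    exact integral_mono ((hi κ hκ).1.sub (hi κ hκ).2).abs hκi hle
  have hn : ∀ κ : Measure X, IsProbabilityMeasure κ → Integrable (fun x => ‖φ x - g x‖) κ :=
    fun κ hκ => ((hi κ hκ).1.sub (g.integrable κ)).norm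
  rw [integral_add_measure (hn μ inferInstance) (hn ν inferInstance)] at hg
  have e1 := abs_le.1 (hb μ inferInstance (hn μ inferInstance))
  have e2 := abs_le.1 (hb ν inferInstance (hn ν inferInstance))
  have e3 := abs_le.1 (h ψ hψc hψ1)
  exact abs_le.2 ⟨by linarith, by linarith⟩

end TotalVariation

/-! ### Cameron-Martin shifts of Gaussian measures -/

section GaussianShift

theorem gaussianPDFReal_self_mean {v : ℝ≥0} (hv : v ≠ 0) (x : ℝ) :
    gaussianPDFReal v v x = gaussianPDFReal 0 v x * Real.exp (x - v / 2) := by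
  rw [gaussianPDFReal, gaussianPDFReal, mul_assoc (√(2 * Real.pi * v))⁻¹, ← Real.exp_add]
  have : (v : ℝ) ≠ 0 := NNReal.coe_ne_zero.2 hv
  congr 2
  field_simp
  ring

theorem integral_exp_mul_gaussianReal (v : ℝ≥0) (t : ℝ) :
    ∫ x, Real.exp (t * x) ∂gaussianReal 0 v = Real.exp (v * t ^ 2 / 2) := by
  have := mgf_gaussianReal (p := gaussianReal 0 v) (X := id) Measure.map_id t
  simpa [mgf] using this

/-- With mean equal to variance the relative density is `ρ(x) = exp(x - v/2)`, and `∫ (ρ - 1)² = e^v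
- 1 ≤ 2v` for `v ≤ 1`. For `v ≥ 1` the trivial bound `2` is enough. -/
theorem tvClose_gaussianReal {v : ℝ≥0} (hv : v ≠ 0) :
    TVClose (gaussianReal v v) (gaussianReal 0 v) (2 * √v) := by
  rcases le_total 1 (v : ℝ) with h1v | h1v
  · exact (tvClose_two _ _).mono (by nlinarith [Real.one_le_sqrt.2 h1v])
  intro ψ hψ hψ1
  set ρ : ℝ → ℝ := fun x => Real.exp (x - v / 2) with hρ
  have hρ1 : ∀ x, ρ x = Real.exp (-(v / 2)) * Real.exp (1 * x) := by
    intro x; rw [hρ, ← Real.exp_add]; ring_nf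
  have hρ2 : ∀ x, ρ x ^ 2 = Real.exp (-v) * Real.exp (2 * x) := by
    intro x; rw [hρ, ← Real.exp_add, ← Real.exp_nat_mul]; push_cast; ring_nf
  have hi1 : Integrable ρ (gaussianReal 0 v) := by
    rw [funext hρ1]; exact (integrable_exp_mul_gaussianReal 1).const_mul _
  have hi2 : Integrable (fun x => ρ x ^ 2) (gaussianReal 0 v) := by
    rw [funext hρ2]; exact (integrable_exp_mul_gaussianReal 2).const_mul _
  have he1 : ∫ x, ρ x ∂gaussianReal 0 v = 1 := by
    simp_rw [hρ1]
    rw [integral_const_mul, integral_exp_mul_gaussianReal, ← Real.exp_add]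
    ring_nf; exact Real.exp_zero
  have he2 : ∫ x, ρ x ^ 2 ∂gaussianReal 0 v = Real.exp v := by
    simp_rw [hρ2]
    rw [integral_const_mul, integral_exp_mul_gaussianReal, ← Real.exp_add]
    ring_nf
  have hψi := integrable_of_abs_le_one (μ := gaussianReal 0 v) hψ hψ1
  have hψρ : Integrable (fun x => ψ x * ρ x) (gaussianReal 0 v) :=
    hi1.bdd_mul hψ.aestronglyMeasurable (ae_of_all _ hψ1)
  have hchange : ∫ x, ψ x ∂gaussianReal v v = ∫ x, ψ x * ρ x ∂gaussianReal 0 v := by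
    rw [integral_gaussianReal_eq_integral_smul hv, integral_gaussianReal_eq_integral_smul hv]
    refine integral_congr_ae (ae_of_all _ fun x => ?_)
    simp only [gaussianPDFReal_self_mean hv, smul_eq_mul, hρ]
    ring
  have hs : 0 < √(v : ℝ) := Real.sqrt_pos.2 (by positivity)
  have hss : √(v : ℝ) ^ 2 = v := Real.sq_sqrt v.2
  rw [hchange, ← integral_sub hψρ hψi]
  have hexp : Real.exp v - 1 ≤ 2 * v := by
    have := Real.abs_exp_sub_one_le (x := v) (by rwa [abs_of_nonneg v.coe_nonneg])
    rw [abs_of_nonneg v.coe_nonneg] at this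
    exact (le_abs_self _).trans this
  have hsqi : Integrable (fun x => ρ x ^ 2 - 2 * ρ x + 1) (gaussianReal 0 v) :=
    (hi2.sub (hi1.const_mul 2)).add (integrable_const 1)
  have hsq : ∫ x, (ρ x ^ 2 - 2 * ρ x + 1) ∂gaussianReal 0 v = Real.exp v - 1 := by
    have hi3 : Integrable (fun x => ρ x ^ 2 - 2 * ρ x) (gaussianReal 0 v) :=
      hi2.sub (hi1.const_mul 2)
    rw [integral_add hi3 (integrable_const 1), integral_sub hi2 (hi1.const_mul 2),
      integral_const_mul, he1, he2]
    simp; ring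
  calc |∫ x, (ψ x * ρ x - ψ x) ∂gaussianReal 0 v|
      ≤ ∫ x, |ψ x * ρ x - ψ x| ∂gaussianReal 0 v := abs_integral_le_integral_abs
    -- The inequality `2ab ≤ a² + b²` with `a = |ρ - 1|` and `b = √v` replaces Cauchy-Schwarz.
    _ ≤ ∫ x, ((2 * √(v : ℝ))⁻¹ * (ρ x ^ 2 - 2 * ρ x + 1) + √v / 2) ∂gaussianReal 0 v := by
        refine integral_mono (hψρ.sub hψi).abs ((hsqi.const_mul _).add (integrable_const _))
          fun x => ?_
        have e1 : |ψ x * ρ x - ψ x| ≤ |ρ x - 1| := by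
          rw [← mul_sub_one, abs_mul]
          exact mul_le_of_le_one_left (abs_nonneg _) (hψ1 x)
        refine e1.trans ?_
        have e2 : (2 * √(v : ℝ))⁻¹ * (ρ x ^ 2 - 2 * ρ x + 1) + √v / 2
            = (|ρ x - 1| ^ 2 + √(v : ℝ) ^ 2) / (2 * √(v : ℝ)) := by
          rw [sq_abs]; field_simp; ring
        rw [e2, le_div_iff₀ (by positivity)]
        nlinarith [sq_nonneg (|ρ x - 1| - √(v : ℝ))]
    _ = (2 * √(v : ℝ))⁻¹ * (Real.exp v - 1) + √v / 2 := by
        rw [integral_add (hsqi.const_mul _) (integrable_const _), integral_const_mul, hsq]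
        simp
    _ ≤ (2 * √(v : ℝ))⁻¹ * (2 * √(v : ℝ) ^ 2) + √v / 2 := by
        rw [hss]; gcongr
    _ ≤ 2 * √v := by
        have : (2 * √(v : ℝ))⁻¹ * (2 * √(v : ℝ) ^ 2) = √v := by field_simp
        rw [this]; linarith

variable {H : Type*} [NormedAddCommGroup H] [InnerProductSpace ℝ H] [CompleteSpace H]
  [SecondCountableTopology H] [MeasurableSpace H] [BorelSpace H]

theorem charFun_map_clm {E : Type*} [NormedAddCommGroup E] [InnerProductSpace ℝ E] [CompleteSpace E]
    [MeasurableSpace E] [BorelSpace E] (μ : Measure E) (A : E →L[ℝ] H) (u : H) :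
    charFun (μ.map A) u = charFun μ (ContinuousLinearMap.adjoint A u) := by
  rw [charFun_apply, charFun_apply, integral_map A.continuous.aemeasurable (by fun_prop)]
  simp_rw [ContinuousLinearMap.adjoint_inner_right]

/-- Shifting `N(0, R²)` by `R² k`: only a one-dimensional marginal is changed. -/
theorem tvClose_map_add_sq {m : Measure H} [IsProbabilityMeasure m] {R : H →L[ℝ] H}
    (hR : R.IsPositive) (hm : ∀ u, charFun m u = Complex.exp (-((‖R u‖ ^ 2 : ℝ) : ℂ) / 2)) (k : H) :
    TVClose (m.map (· + R (R k))) m (2 * ‖R k‖) := by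
  have hsym : ∀ x y, inner ℝ (R x) y = inner ℝ x (R y) := hR.isSymmetric
  by_cases hk : R k = 0
  · intro φ _ _
    simp [hk]
  have hpos : 0 < ‖R k‖ := norm_pos_iff.2 hk
  -- For `X` of law `m`, `v` is the variance of `⟨k, X⟩`. Split `X = B X + ⟨k, X⟩ w` with `w = v⁻¹
  -- R² k`: the two summands are uncorrelated, hence independent. Shifting `X` by `a w` only changes
  -- the mean of the scalar Gaussian to `a`, and `a = v` is the shift by `R² k`.
  set v : ℝ≥0 := ⟨‖R k‖ ^ 2, by positivity⟩ with hvdef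
  have hv : v ≠ 0 := by
    rw [← NNReal.coe_ne_zero]; exact (pow_pos hpos 2).ne'
  have hvR : (v : ℝ) = ‖R k‖ ^ 2 := rfl
  set w : H := (‖R k‖ ^ 2)⁻¹ • R (R k) with hw
  have hvw : (v : ℝ) • w = R (R k) := by
    rw [hvR, hw, smul_smul, mul_inv_cancel₀ (pow_pos hpos 2).ne', one_smul]
  set A : ℝ →L[ℝ] H := (ContinuousLinearMap.id ℝ ℝ).smulRight w with hA
  set B : H →L[ℝ] H := ContinuousLinearMap.id ℝ H - (innerSL ℝ k).smulRight w with hB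
  have hAadj : ∀ u, ContinuousLinearMap.adjoint A u = inner ℝ w u := by
    intro u
    refine ext_inner_left ℝ fun x => ?_
    rw [ContinuousLinearMap.adjoint_inner_right]
    simp [hA, inner_smul_left, mul_comm]
  have hBadj : ∀ u, ContinuousLinearMap.adjoint B u = u - inner ℝ w u • k := by
    intro u
    refine ext_inner_left ℝ fun x => ?_
    rw [ContinuousLinearMap.adjoint_inner_right]
    simp only [hB, sub_apply, ContinuousLinearMap.id_apply, ContinuousLinearMap.smulRight_apply,
      innerSL_apply_apply, inner_sub_left, inner_sub_right, real_inner_smul_left,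
      real_inner_smul_right, real_inner_comm k x]
    ring
  have hquad : ∀ u, ‖R (ContinuousLinearMap.adjoint B u)‖ ^ 2 = ‖R u‖ ^ 2 - v * inner ℝ w u ^ 2 := by
    intro u
    have h1 : inner ℝ (R u) (R k) = v * inner ℝ w u := by
      rw [hsym, ← hvw, real_inner_smul_right, real_inner_comm]
    rw [hBadj, map_sub, map_smul, norm_sub_sq_real, real_inner_smul_right, h1, norm_smul, mul_pow,
      Real.norm_eq_abs, sq_abs, ← hvR]
    ring
  have hgen : ∀ a : ℝ, m.map (· + a • w) = (m.map B) ∗ ((gaussianReal a v).map A) := by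
    intro a
    have : IsProbabilityMeasure (m.map (· + a • w)) :=
      Measure.isProbabilityMeasure_map (by fun_prop)
    have : IsProbabilityMeasure (m.map B) :=
      Measure.isProbabilityMeasure_map B.continuous.aemeasurable
    have : IsProbabilityMeasure ((gaussianReal a v).map A) :=
      Measure.isProbabilityMeasure_map A.continuous.aemeasurable
    refine Measure.ext_of_charFun (funext fun u => ?_)
    rw [charFun_conv, charFun_map_clm, charFun_map_clm, charFun_map_add_const, hm, hm, hquad, hAadj,
      charFun_gaussianReal, ← Complex.exp_add, ← Complex.exp_add, real_inner_smul_left]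
    congr 1
    push_cast
    ring
  have h0 : m = (m.map B) ∗ ((gaussianReal 0 v).map A) := by
    rw [← hgen 0]; simp
  have : IsProbabilityMeasure (m.map B) :=
    Measure.isProbabilityMeasure_map B.continuous.aemeasurable
  have hAp : ∀ a, IsProbabilityMeasure ((gaussianReal a v).map A) := fun a =>
    Measure.isProbabilityMeasure_map A.continuous.aemeasurable
  have key := ((tvClose_gaussianReal hv).map A.continuous.measurable).conv_left (m.map B)
  rw [← hgen, ← h0, hvw, hvR, Real.sqrt_sq hpos.le] at key
  exact key

/-- Cameron-Martin: shifting `N(0, R²)` by `R h` changes it by at most `2 ‖h‖` in total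
variation. -/
theorem tvClose_map_add {m : Measure H} [IsProbabilityMeasure m] {R : H →L[ℝ] H}
    (hR : R.IsPositive) (hm : ∀ u, charFun m u = Complex.exp (-((‖R u‖ ^ 2 : ℝ) : ℂ) / 2)) {h : H}
    (hh : h ∈ closure (range R)) : TVClose (m.map (· + R h)) m (2 * ‖h‖) := by
  -- Approximate `h` by vectors `R (k n)`, whose shifts `R (R (k n))` are already controlled; the
  -- bound passes to the limit on continuous test functions.
  obtain ⟨x, hx, hxh⟩ := mem_closure_iff_seq_limit.1 hh
  choose k hk using hx
  have : IsProbabilityMeasure (m.map (· + R h)) := Measure.isProbabilityMeasure_map (by fun_prop)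
  refine tvClose_of_continuous fun φ hφ h1 => ?_
  have hlim : Tendsto (fun n => ∫ z, φ (z + R (x n)) ∂m) atTop (𝓝 (∫ z, φ (z + R h) ∂m)) := by
    refine tendsto_integral_of_dominated_convergence (fun _ => 1)
      (fun n => (by fun_prop : Continuous fun z => φ (z + R (x n))).aestronglyMeasurable)
      (integrable_const _) (fun n => ae_of_all _ fun z => h1 _) (ae_of_all _ fun z => ?_)
    exact ((by fun_prop : Continuous fun y => φ (z + R y)).tendsto h).comp hxh
  rw [integral_map (by fun_prop) hφ.aestronglyMeasurable]
  refine le_of_tendsto_of_tendsto ((hlim.sub_const _).abs) ((hxh.norm).const_mul 2)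
    (Eventually.of_forall fun n => ?_)
  have := tvClose_map_add_sq hR hm (k n) φ hφ.measurable h1
  rw [integral_map (by fun_prop) hφ.aestronglyMeasurable, hk] at this
  exact this

/-- If `range A ⊆ range R`, then `A x = R h` for some `h` in the closure of the range of `R` with
`‖h‖ ≤ C ‖x‖`. -/
theorem exists_preimage_norm_le {E : Type*} [NormedAddCommGroup E] [InnerProductSpace ℝ E]
    [CompleteSpace E] {R A : E →L[ℝ] E} (hR : R.IsPositive) (hrange : range A ⊆ range R) :
    ∃ C : ℝ, 0 ≤ C ∧ ∀ x, ∃ h ∈ closure (range R), R h = A x ∧ ‖h‖ ≤ C * ‖x‖ := by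
  -- Since `R` is self-adjoint, the complement of its range is killed by `R`. Projecting it away
  -- puts preimages in `V`, where `R` is injective; uniqueness then makes the choice linear.
  set V : Submodule ℝ E := R.rangeᗮᗮ with hV
  have hVcl : (V : Set E) = closure (range R) := by
    rw [hV, Submodule.orthogonal_orthogonal_eq_closure, Submodule.topologicalClosure_coe]
    rfl
  have hker : ∀ y ∈ R.rangeᗮ, R y = 0 := by
    intro y hy
    rw [Submodule.mem_orthogonal] at hy
    have h1 : inner ℝ (R (R y)) y = (0 : ℝ) := hy _ ⟨R y, rfl⟩
    have h2 : inner ℝ (R (R y)) y = inner ℝ (R y) (R y) := hR.isSymmetric _ _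
    rw [h2] at h1
    exact inner_self_eq_zero.1 h1
  have hex : ∀ x, ∃ h : E, h ∈ V ∧ R h = A x := by
    intro x
    obtain ⟨y, hy⟩ := hrange ⟨x, rfl⟩
    refine ⟨y - R.rangeᗮ.starProjection y, ?_, ?_⟩
    · exact Submodule.sub_starProjection_mem_orthogonal y
    · rw [map_sub, hker _ (Submodule.starProjection_apply_mem _ _), sub_zero, hy]
  choose g hgV hg using hex
  have huniq : ∀ a ∈ V, ∀ b ∈ V, R a = R b → a = b := by
    intro a ha b hb hab
    have h1 : a - b ∈ V := V.sub_mem ha hb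
    have h2 : a - b ∈ R.rangeᗮ := by
      rw [Submodule.mem_orthogonal]
      rintro _ ⟨z, rfl⟩
      have : inner ℝ (R z) (a - b) = inner ℝ z (R (a - b)) := hR.isSymmetric _ _
      refine this.trans ?_
      rw [map_sub, hab, sub_self, inner_zero_right]
    have h3 := (Submodule.mem_orthogonal _ _).1 h1 _ h2
    exact sub_eq_zero.1 (inner_self_eq_zero.1 h3)
  let G : E →ₗ[ℝ] E :=
    { toFun := g
      map_add' := fun x y => huniq _ (hgV _) _ (V.add_mem (hgV x) (hgV y)) (by
        rw [map_add, hg, hg, hg, map_add])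
      map_smul' := fun c x => huniq _ (hgV _) _ (V.smul_mem c (hgV x)) (by
        rw [map_smul, hg, hg, map_smul]; rfl) }
  -- Closed graph theorem; the operator norm of `G` is the required constant.
  have hGc : Continuous G := by
    refine G.continuous_of_seq_closed_graph fun u x y hu hGu => ?_
    have hyV : y ∈ V := by
      have hcl : IsClosed (V : Set E) := Submodule.isClosed_orthogonal _
      exact hcl.mem_of_tendsto hGu (Eventually.of_forall fun n => hgV _)
    refine huniq _ hyV _ (hgV _) ?_
    change R y = R (g x)
    rw [hg]
    have h1 : Tendsto (fun n => R (g (u n))) atTop (𝓝 (R y)) := (R.continuous.tendsto y).comp hGu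
    simp_rw [hg] at h1
    exact tendsto_nhds_unique h1 ((A.continuous.tendsto x).comp hu)
  refine ⟨‖(⟨G, hGc⟩ : E →L[ℝ] E)‖, norm_nonneg _, fun x => ⟨g x, hVcl ▸ hgV x, hg x, ?_⟩⟩
  exact (⟨G, hGc⟩ : E →L[ℝ] E).le_opNorm x

end GaussianShift

/-! ### The law of a geometric random series -/

section RandomSeries

variable {H : Type*} [NormedAddCommGroup H] [InnerProductSpace ℝ H] [CompleteSpace H]
  [SecondCountableTopology H] [MeasurableSpace H] [BorelSpace H]

/-- The law of `∑ Aⁿ Zₙ` with independent `Zₙ` of law `m`. -/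
theorem exists_law_tsum_pow (m : Measure H) [IsProbabilityMeasure m] (hm : Integrable (fun z => z) m)
    {A : H →L[ℝ] H} (hA : ‖A‖ < 1) :
    ∃ μ : Measure H, IsProbabilityMeasure μ ∧ Integrable (fun x => x) μ ∧
      ∀ u, Tendsto (fun N => ∏ n ∈ Finset.range N,
        charFun m (ContinuousLinearMap.adjoint (A ^ n) u)) atTop (𝓝 (charFun μ u)) := by
  set ℙ' : Measure (ℕ → H) := Measure.infinitePi fun _ => m with hP
  have hmeas : ∀ n : ℕ, Measurable fun ω : ℕ → H => (A ^ n) (ω n) := fun n =>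
    (A ^ n).continuous.measurable.comp (measurable_pi_apply n)
  have heval : ∀ n : ℕ, ℙ'.map (fun ω => ω n) = m := fun n =>
    Measure.infinitePi_map_eval (fun _ => m) n
  have hmap : ∀ n : ℕ, ℙ'.map (fun ω => (A ^ n) (ω n)) = m.map (A ^ n) := fun n => by
    conv_rhs => rw [← heval n]
    rw [Measure.map_map (A ^ n).continuous.measurable (measurable_pi_apply n)]
    rfl
  -- The expected sum of norms is at most `∑ ‖A‖ⁿ` times the first moment of `m`. This gives both
  -- almost sure absolute convergence and integrability of the sum.
  have hfin : ∫⁻ ω, ∑' n, ‖(A ^ n) (ω n)‖ₑ ∂ℙ' < ∞ := by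
    rw [lintegral_tsum fun n => (hmeas n).enorm.aemeasurable]
    have hle : ∀ n, ∫⁻ ω, ‖(A ^ n) (ω n)‖ₑ ∂ℙ' ≤ ENNReal.ofReal (‖A‖ ^ n) * ∫⁻ z, ‖z‖ₑ ∂m := by
      intro n
      have : ∫⁻ ω, ‖(A ^ n) (ω n)‖ₑ ∂ℙ' = ∫⁻ z, ‖(A ^ n) z‖ₑ ∂m := by
        conv_rhs => rw [← heval n]
        rw [lintegral_map (A ^ n).continuous.measurable.enorm (measurable_pi_apply n)]
      rw [this, ← lintegral_const_mul _ measurable_enorm]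
      refine lintegral_mono fun z => ?_
      rw [← ofReal_norm, ← ofReal_norm, ← ENNReal.ofReal_mul (by positivity)]
      refine ENNReal.ofReal_le_ofReal (((A ^ n).le_opNorm z).trans ?_)
      gcongr
      rcases Nat.eq_zero_or_pos n with h0 | h0
      · rw [h0, pow_zero, pow_zero]; exact ContinuousLinearMap.norm_id_le
      · exact norm_pow_le' _ h0
    refine (ENNReal.tsum_le_tsum hle).trans_lt ?_
    rw [ENNReal.tsum_mul_right, ← ENNReal.ofReal_tsum_of_nonneg (fun _ => by positivity)
      (summable_geometric_of_lt_one (norm_nonneg _) hA)]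
    exact ENNReal.mul_lt_top ENNReal.ofReal_lt_top hm.2
  have hsum : ∀ᵐ ω ∂ℙ', Summable fun n => (A ^ n) (ω n) := by
    filter_upwards [ae_lt_top' (AEMeasurable.tsum fun n => (hmeas n).enorm.aemeasurable)
      hfin.ne] with ω hω
    refine Summable.of_norm ?_
    have h1 := ENNReal.summable_toReal hω.ne
    simpa using h1
  set X : (ℕ → H) → H := fun ω => ∑' n, (A ^ n) (ω n) with hX
  have htend : ∀ᵐ ω ∂ℙ', Tendsto (fun N => ∑ n ∈ Finset.range N, (A ^ n) (ω n)) atTop (𝓝 (X ω)) := by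
    filter_upwards [hsum] with ω hω
    exact hω.hasSum.tendsto_sum_nat
  have hpm : ∀ N, Measurable fun ω : ℕ → H => ∑ n ∈ Finset.range N, (A ^ n) (ω n) := fun N =>
    Finset.measurable_sum _ fun n _ => hmeas n
  have hXm : AEMeasurable X ℙ' :=
    aemeasurable_of_tendsto_metrizable_ae atTop (fun N => (hpm N).aemeasurable) htend
  refine ⟨ℙ'.map X, Measure.isProbabilityMeasure_map hXm, ?_, fun u => ?_⟩
  · refine (integrable_map_measure (by fun_prop) hXm).2 ⟨hXm.aestronglyMeasurable, ?_⟩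
    exact (lintegral_mono fun ω => enorm_tsum_le_tsum_enorm).trans_lt hfin
  · have hprod : ∀ N, ∏ n ∈ Finset.range N, charFun m (ContinuousLinearMap.adjoint (A ^ n) u)
        = ∫ ω, Complex.exp (inner ℝ (∑ n ∈ Finset.range N, (A ^ n) (ω n)) u * Complex.I) ∂ℙ' := by
      intro N
      have hind : iIndepFun (fun n (ω : ℕ → H) => (A ^ n) (ω n)) ℙ' :=
        iIndepFun_infinitePi (X := fun n z => (A ^ n) z) fun n => (A ^ n).continuous.measurable
      have h1 := (hind.restrict (Finset.range N)).charFun_map_fun_finsetSum_eq_prod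
        (fun n _ => (hmeas n).aemeasurable)
      have h2 := congrFun h1 u
      rw [charFun_apply, integral_map (hpm N).aemeasurable (by fun_prop), Finset.prod_apply] at h2
      rw [h2]
      exact Finset.prod_congr rfl fun n _ => by rw [hmap, charFun_map_clm]
    simp_rw [hprod]
    rw [charFun_apply, integral_map hXm (by fun_prop)]
    refine tendsto_integral_of_dominated_convergence (fun _ => 1)
      (fun N => ((by fun_prop : Continuous fun x : H =>
        Complex.exp ((inner ℝ x u : ℝ) * Complex.I)).measurable.comp (hpm N)).aestronglyMeasurable)
      (integrable_const _) (fun N => ae_of_all _ fun ω => ?_) ?_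
    · rw [Complex.norm_exp_ofReal_mul_I]
    · filter_upwards [htend] with ω hω
      exact ((by fun_prop : Continuous fun x : H =>
        Complex.exp ((inner ℝ x u : ℝ) * Complex.I)).tendsto _).comp hω

end RandomSeries

/-! ### Existence and uniqueness of the invariant measure -/

section Invariant

set_option linter.unusedSectionVars false

variable {Ω K K' H : Type*} [MeasurableSpace Ω] {P : Measure Ω} [IsProbabilityMeasure P]
  [NormedAddCommGroup K] [InnerProductSpace ℝ K] [CompleteSpace K] [SecondCountableTopology K]
  [NormedAddCommGroup K'] [InnerProductSpace ℝ K'] [CompleteSpace K'] [MeasurableSpace K']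
  [SecondCountableTopology K'] [BorelSpace K']
  [NormedAddCommGroup H] [InnerProductSpace ℝ H] [CompleteSpace H]
  [SecondCountableTopology H] [MeasurableSpace H] [BorelSpace H]
  {ι : K →L[ℝ] K'} {W : ℝ≥0 → Ω → K'} {S : ℝ → H →L[ℝ] H} {Q : K →L[ℝ] H}

theorem charFun_convLaw (hS : IsC0Semigroup S) (hW : IsCylindricalWiener P ι W)
    (hsol : ∀ x₀ : H, ∃ x : ℝ → Ω → H, IsMildSolution P ι W S Q x₀ x) {t : ℝ} (ht : 0 ≤ t) (u : H) :
    charFun (convLaw P ι W S Q t) u = Complex.exp (-(covForm S Q t u : ℂ) / 2) :=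
  (isStochIntegral_stochConv hsol ht).charFun_map hW hS ht u

theorem integrable_convLaw (hW : IsCylindricalWiener P ι W)
    (hsol : ∀ x₀ : H, ∃ x : ℝ → Ω → H, IsMildSolution P ι W S Q x₀ x) {t : ℝ} (ht : 0 ≤ t) :
    Integrable (fun z => z) (convLaw P ι W S Q t) := by
  have h := isStochIntegral_stochConv hsol ht
  exact (integrable_map_measure (by fun_prop) h.1.aemeasurable).2
    ((h.memLp hW).integrable one_le_two)

instance isProbabilityMeasure_evolve (t : ℝ) (ν : Measure H) [IsProbabilityMeasure ν] :
    IsProbabilityMeasure (evolve P ι W S Q t ν) := by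
  have := Measure.isProbabilityMeasure_map (μ := ν) (S t).continuous.aemeasurable
  rw [evolve_eq_conv]
  infer_instance

theorem charFun_evolve (hS : IsC0Semigroup S) (hW : IsCylindricalWiener P ι W)
    (hsol : ∀ x₀ : H, ∃ x : ℝ → Ω → H, IsMildSolution P ι W S Q x₀ x) {t : ℝ} (ht : 0 ≤ t)
    (ν : Measure H) [IsProbabilityMeasure ν] (u : H) :
    charFun (evolve P ι W S Q t ν) u = charFun ν (ContinuousLinearMap.adjoint (S t) u) *
      Complex.exp (-(covForm S Q t u : ℂ) / 2) := by
  have := Measure.isProbabilityMeasure_map (μ := ν) (S t).continuous.aemeasurable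
  rw [evolve_eq_conv, charFun_conv, charFun_map_clm, charFun_convLaw hS hW hsol ht]

/-- Iterating `covForm_add` identifies the partial sums of the random series as `N(0, Q_{NT})`. -/
theorem IsC0Semigroup.covForm_nat_mul (hS : IsC0Semigroup S) {T : ℝ} (hT : 0 ≤ T) (u : H) (N : ℕ) :
    ∏ n ∈ Finset.range N, Complex.exp
      (-(covForm S Q T (ContinuousLinearMap.adjoint (S T ^ n) u) : ℂ) / 2)
      = Complex.exp (-(covForm S Q (N * T) u : ℂ) / 2) := by
  induction N with
  | zero => simp [covForm]
  | succ N ih =>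
    rw [Finset.prod_range_succ, ih, Nat.cast_succ, add_mul, one_mul,
      hS.covForm_add (by positivity) hT, hS.map_nat_mul hT, ← Complex.exp_add]
    congr 1
    push_cast
    ring

theorem IsC0Semigroup.tendsto_adjoint_nat_mul (hS : IsC0Semigroup S) {T : ℝ} (hT : 0 ≤ T)
    (hnorm : ‖S T‖ < 1) (u : H) :
    Tendsto (fun N : ℕ => ContinuousLinearMap.adjoint (S (N * T)) u) atTop (𝓝 0) := by
  have h1 : Tendsto (fun N : ℕ => ‖S T‖ ^ N * ‖u‖) atTop (𝓝 0) := by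
    simpa using (tendsto_pow_atTop_nhds_zero_of_lt_one (norm_nonneg _) hnorm).mul_const ‖u‖
  refine squeeze_zero_norm' ?_ h1
  filter_upwards [eventually_gt_atTop 0] with N hN
  refine (ContinuousLinearMap.le_opNorm _ _).trans ?_
  rw [LinearIsometryEquiv.norm_map, hS.map_nat_mul hT]
  gcongr
  exact norm_pow_le' _ hN

/-- Invariance follows by splitting `Q_{t+NT}` in both orders: `Q_t + S(t) Q_{NT} S(t)* = Q_{NT} +
S(NT) Q_t S(NT)*`, where the last term tends to `0` as a quadratic form. The first moment and the
limit formula are kept for mixing and uniqueness. -/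
theorem exists_isInvariantMeasure (hS : IsC0Semigroup S) (hW : IsCylindricalWiener P ι W)
    (hsol : ∀ x₀ : H, ∃ x : ℝ → Ω → H, IsMildSolution P ι W S Q x₀ x) {T : ℝ} (hT : 0 ≤ T)
    (hnorm : ‖S T‖ < 1) :
    ∃ μ : Measure H, IsInvariantMeasure P ι W S Q μ ∧ Integrable (fun x => x) μ ∧
      ∀ u, Tendsto (fun N : ℕ => Complex.exp (-(covForm S Q (N * T) u : ℂ) / 2)) atTop
        (𝓝 (charFun μ u)) := by
  obtain ⟨μ, hμ, hμi, hlim⟩ := exists_law_tsum_pow (convLaw P ι W S Q T)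
    (integrable_convLaw hW hsol hT) hnorm
  simp_rw [charFun_convLaw hS hW hsol hT, hS.covForm_nat_mul hT] at hlim
  refine ⟨μ, ⟨hμ, fun t ht => Measure.ext_of_charFun (funext fun u => ?_)⟩, hμi, hlim⟩
  rw [charFun_evolve hS hW hsol ht.le]
  have h1 := (hlim (ContinuousLinearMap.adjoint (S t) u)).mul_const
    (Complex.exp (-(covForm S Q t u : ℂ) / 2))
  have hzero : Tendsto (fun N : ℕ => covForm S Q t (ContinuousLinearMap.adjoint (S (N * T)) u))
      atTop (𝓝 0) := by
    obtain ⟨C, hC⟩ := hS.exists_covForm_le Q ht.le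
    have h2 := (((hS.tendsto_adjoint_nat_mul hT hnorm u).norm).pow 2).const_mul C
    rw [norm_zero, zero_pow two_ne_zero, mul_zero] at h2
    exact squeeze_zero (fun N => covForm_nonneg ht.le _) (fun N => hC _) h2
  have h3 := (hlim u).mul (((by fun_prop : Continuous fun x : ℝ =>
    Complex.exp (-(x : ℂ) / 2)).tendsto 0).comp hzero)
  simp only [Complex.ofReal_zero, neg_zero, zero_div, Complex.exp_zero, mul_one] at h3
  refine tendsto_nhds_unique (h1.congr fun N => ?_) h3
  rw [Function.comp_apply, ← Complex.exp_add, ← Complex.exp_add]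
  congr 1
  have h4 := hS.covForm_add (Q := Q) ht.le (by positivity : 0 ≤ N * T) u
  have h5 := hS.covForm_add (Q := Q) (by positivity : 0 ≤ N * T) ht.le u
  rw [add_comm] at h5
  have h6 := congrArg (fun x : ℝ => (x : ℂ)) (h4.symm.trans h5)
  push_cast at h6
  linear_combination (-1 / 2 : ℂ) * h6

/-- Invariance at time `NT` factors the characteristic function of `μ'` into its value at `S(NT)*
u`, which tends to `1`, and the characteristic function of `N(0, Q_{NT})`. No moment of `μ'` is
required. -/
theorem IsInvariantMeasure.eq_of_tendsto (hS : IsC0Semigroup S) (hW : IsCylindricalWiener P ι W)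
    (hsol : ∀ x₀ : H, ∃ x : ℝ → Ω → H, IsMildSolution P ι W S Q x₀ x) {T : ℝ} (hT : 0 < T)
    (hnorm : ‖S T‖ < 1) {μ μ' : Measure H} [IsProbabilityMeasure μ]
    (hμ : ∀ u, Tendsto (fun N : ℕ => Complex.exp (-(covForm S Q (N * T) u : ℂ) / 2)) atTop
        (𝓝 (charFun μ u))) (hμ' : IsInvariantMeasure P ι W S Q μ') : μ' = μ := by
  have := hμ'.1
  refine Measure.ext_of_charFun (funext fun u => ?_)
  have h1 := (((continuous_charFun (μ := μ')).tendsto 0).comp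
    (hS.tendsto_adjoint_nat_mul hT.le hnorm u)).mul (hμ u)
  rw [charFun_zero, probReal_univ, Complex.ofReal_one, one_mul] at h1
  refine tendsto_nhds_unique (tendsto_const_nhds.congr' ?_) h1
  filter_upwards [eventually_gt_atTop 0] with N hN
  have hNT : 0 < N * T := by positivity
  have h2 := charFun_evolve hS hW hsol hNT.le μ' u
  rw [hμ'.2 _ hNT] at h2
  exact h2

end Invariant

theorem tvClose_map_conv {E H : Type*} [NormedAddCommGroup E] [NormedSpace ℝ E] [MeasurableSpace E]
    [BorelSpace E] [NormedAddCommGroup H] [NormedSpace ℝ H]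
    [SecondCountableTopology H] [MeasurableSpace H] [BorelSpace H] {ν : Measure E}
    [IsProbabilityMeasure ν] (hν : Integrable (fun x => x) ν) {m : Measure H}
    [IsProbabilityMeasure m] {A : E →L[ℝ] H} {c : ℝ}
    (h : ∀ x, TVClose (m.map (· + A x)) m (c * ‖x‖)) :
    TVClose ((ν.map A) ∗ m) m (c * ∫ x, ‖x‖ ∂ν) := by
  have := Measure.isProbabilityMeasure_map (μ := ν) A.continuous.aemeasurable
  intro φ hφ h1
  have hsm : StronglyMeasurable fun a => ∫ z, φ (a + z) ∂m :=
    StronglyMeasurable.integral_prod_right' (f := fun p : H × H => φ (p.1 + p.2))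
      (hφ.comp measurable_add).stronglyMeasurable
  have hi : Integrable (fun x => ∫ z, φ (A x + z) ∂m) ν :=
    Integrable.of_bound (hsm.comp_measurable A.continuous.measurable).aestronglyMeasurable 1
      (ae_of_all _ fun x => abs_integral_le_one fun y => h1 _)
  rw [integral_conv (integrable_of_abs_le_one hφ h1),
    integral_map A.continuous.aemeasurable hsm.aestronglyMeasurable]
  have h2 : ∫ z, φ z ∂m = ∫ _, ∫ z, φ z ∂m ∂ν := by simp
  rw [h2, ← integral_sub hi (integrable_const _), ← integral_const_mul]
  refine abs_integral_le_integral_abs.trans ?_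
  refine integral_mono (hi.sub (integrable_const _)).abs (hν.norm.const_mul c) fun x => ?_
  have h3 := h x φ hφ h1
  rw [integral_map (by fun_prop) hφ.aestronglyMeasurable] at h3
  simp_rw [add_comm _ (A x)] at h3
  exact h3

/-! ### Strong Feller estimate and exponential mixing -/

section Main

set_option linter.unusedSectionVars false

variable {Ω K K' H : Type*} [MeasurableSpace Ω] {P : Measure Ω} [IsProbabilityMeasure P]
  [NormedAddCommGroup K] [InnerProductSpace ℝ K] [CompleteSpace K] [SecondCountableTopology K]
  [NormedAddCommGroup K'] [InnerProductSpace ℝ K'] [CompleteSpace K'] [MeasurableSpace K']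
  [SecondCountableTopology K'] [BorelSpace K']
  [NormedAddCommGroup H] [InnerProductSpace ℝ H] [CompleteSpace H]
  [SecondCountableTopology H] [MeasurableSpace H] [BorelSpace H]
  {ι : K →L[ℝ] K'} {W : ℝ≥0 → Ω → K'} {S : ℝ → H →L[ℝ] H} {Q : K →L[ℝ] H}

theorem convLaw_add (hS : IsC0Semigroup S) (hW : IsCylindricalWiener P ι W)
    (hsol : ∀ x₀ : H, ∃ x : ℝ → Ω → H, IsMildSolution P ι W S Q x₀ x) {s t : ℝ} (hs : 0 ≤ s)
    (ht : 0 ≤ t) : convLaw P ι W S Q (s + t)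
      = ((convLaw P ι W S Q t).map (S s)) ∗ convLaw P ι W S Q s := by
  have := Measure.isProbabilityMeasure_map (μ := convLaw P ι W S Q t) (S s).continuous.aemeasurable
  refine Measure.ext_of_charFun (funext fun u => ?_)
  rw [charFun_conv, charFun_map_clm, charFun_convLaw hS hW hsol (add_nonneg hs ht),
    charFun_convLaw hS hW hsol hs, charFun_convLaw hS hW hsol ht, hS.covForm_add hs ht,
    ← Complex.exp_add]
  congr 1
  push_cast
  ring

/-- The strong Feller estimate for the transition probabilities after time `T`. -/
theorem exists_tvClose_convLaw (hS : IsC0Semigroup S) (hW : IsCylindricalWiener P ι W)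
    (hsol : ∀ x₀ : H, ∃ x : ℝ → Ω → H, IsMildSolution P ι W S Q x₀ x) {T : ℝ} (hT : 0 ≤ T)
    {R : H →L[ℝ] H} (hR : IsPositiveSqrt R (covOp S Q T)) (hrange : range (S T) ⊆ range R) :
    ∃ C : ℝ, 0 ≤ C ∧ ∀ s, 0 ≤ s → ∀ x,
      TVClose ((convLaw P ι W S Q (T + s)).map (· + S (T + s) x)) (convLaw P ι W S Q (T + s))
        (C * ‖S s‖ * ‖x‖) := by
  obtain ⟨C, hC, hpre⟩ := exists_preimage_norm_le hR.1 hrange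
  refine ⟨2 * C, by positivity, fun s hs x => ?_⟩
  have hp := Measure.isProbabilityMeasure_map (μ := convLaw P ι W S Q s) (S T).continuous.aemeasurable
  obtain ⟨h, hh, hRh, hnorm⟩ := hpre (S s x)
  have hshift := tvClose_map_add hR.1 (m := convLaw P ι W S Q T)
    (fun u => by rw [charFun_convLaw hS hW hsol hT, hR.norm_sq_eq_covForm hS hT]) hh
  have hp' : IsProbabilityMeasure ((convLaw P ι W S Q T).map (· + R h)) :=
    Measure.isProbabilityMeasure_map (by fun_prop)
  -- `N(0, Q_{T+s})` is `N(0, Q_T)` convolved with the image of `N(0, Q_s)` under `S(T)`. Writing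
  -- the shift as convolution with a Dirac mass lets associativity move it onto the factor `N(0,
  -- Q_T)`.
  have key := hshift.conv_left ((convLaw P ι W S Q s).map (S T))
  rw [← Measure.conv_dirac, ← Measure.conv_assoc, ← convLaw_add hS hW hsol hT hs,
    Measure.conv_dirac, hRh, ← ContinuousLinearMap.comp_apply, ← hS.map_add T s hT hs] at key
  refine key.mono ?_
  calc 2 * ‖h‖ ≤ 2 * (C * (‖S s‖ * ‖x‖)) := by
        gcongr; exact hnorm.trans (by gcongr; exact (S s).le_opNorm x)
    _ = _ := by ring

theorem exists_exponentially_mixing (hS : IsC0Semigroup S) (hW : IsCylindricalWiener P ι W)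
    (hsol : ∀ x₀ : H, ∃ x : ℝ → Ω → H, IsMildSolution P ι W S Q x₀ x) {T : ℝ} (hT : 0 < T)
    (hnorm : ‖S T‖ < 1) {R : H →L[ℝ] H} (hR : IsPositiveSqrt R (covOp S Q T))
    (hrange : range (S T) ⊆ range R) :
    ∃ μ : Measure H, IsInvariantMeasure P ι W S Q μ ∧
      (∀ μ' : Measure H, IsInvariantMeasure P ι W S Q μ' → μ' = μ) ∧
      ∃ γ : ℝ, 0 < γ ∧ ∀ ν : Measure H, IsProbabilityMeasure ν → Integrable (fun x : H => x) ν →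
        ∃ C : ℝ, ∀ t : ℝ, 0 ≤ t →
          TVClose (evolve P ι W S Q t ν) μ (C * Real.exp (-γ * t)) := by
  obtain ⟨μ, hμ, hμi, hlim⟩ := exists_isInvariantMeasure hS hW hsol hT.le hnorm
  have hμp := hμ.1
  obtain ⟨M, γ, hM, hγ, hSt⟩ := hS.exists_exponential_bound hT hnorm
  obtain ⟨C, hC, hclose⟩ := exists_tvClose_convLaw hS hW hsol hT.le hR hrange
  refine ⟨μ, hμ, fun μ' hμ' => hμ'.eq_of_tendsto hS hW hsol hT hnorm hlim, γ, hγ,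
    fun ν hν hνi => ?_⟩
  set I : ℝ := ∫ x, ‖x‖ ∂ν + ∫ x, ‖x‖ ∂μ with hI
  have hI0 : 0 ≤ I := add_nonneg (integral_nonneg fun _ => norm_nonneg _)
    (integral_nonneg fun _ => norm_nonneg _)
  -- The factor `exp (γ T)` compensates for the estimate starting only at time `T`; the summand `2`
  -- covers `t < T` by the trivial bound.
  refine ⟨Real.exp (γ * T) * (C * M * I + 2), fun t ht => ?_⟩
  have hexp : ∀ r : ℝ, Real.exp (γ * T) * Real.exp (-γ * r) = Real.exp (-γ * (r - T)) := by
    intro r; rw [← Real.exp_add]; ring_nf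
  rcases lt_or_ge t T with htT | htT
  · refine (tvClose_two _ _).mono ?_
    have h1 : 1 ≤ Real.exp (-γ * (t - T)) := Real.one_le_exp (by nlinarith)
    have h2 : 0 ≤ C * M * I := by positivity
    calc (2 : ℝ) ≤ (C * M * I + 2) * Real.exp (-γ * (t - T)) := by nlinarith
      _ = _ := by rw [← hexp]; ring
  · obtain ⟨s, rfl⟩ : ∃ s, t = T + s := ⟨t - T, by ring⟩
    have hs : 0 ≤ s := by linarith
    have h1 := tvClose_map_conv hνi (hclose s hs)
    -- Both `ν` and the invariant `μ` are compared with `convLaw` at time `T + s`, the law started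
    -- from `0`; the triangle inequality adds their first moments.
    have h2 := tvClose_map_conv hμi (hclose s hs)
    rw [← evolve_eq_conv] at h1 h2
    rw [hμ.2 _ (by linarith)] at h2
    intro φ hφ hφ1
    have e1 := abs_le.1 (h1 φ hφ hφ1)
    have e2 := abs_le.1 (h2 φ hφ hφ1)
    have e3 : C * ‖S s‖ * I ≤ Real.exp (γ * T) * (C * M * I + 2) * Real.exp (-γ * (T + s)) := by
      have h3 : Real.exp (γ * T) * (C * M * I + 2) * Real.exp (-γ * (T + s))
          = C * (M * Real.exp (-γ * s)) * I + 2 * Real.exp (-γ * s) := by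
        have := hexp (T + s)
        rw [add_sub_cancel_left] at this
        rw [mul_right_comm, this]; ring
      rw [h3]
      have h4 : C * ‖S s‖ * I ≤ C * (M * Real.exp (-γ * s)) * I := by
        gcongr; exact hSt s hs
      linarith [Real.exp_pos (-γ * s)]
    rw [hI, mul_add] at e3
    exact abs_le.2 ⟨by linarith, by linarith⟩

end Main

end LinearSPDE


theorem mainTheorem10 {Ω K K' H : Type*}
    [MeasurableSpace Ω] (P : Measure Ω) [IsProbabilityMeasure P]
    [NormedAddCommGroup K] [InnerProductSpace ℝ K] [CompleteSpace K] [SecondCountableTopology K]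
    [NormedAddCommGroup K'] [InnerProductSpace ℝ K'] [CompleteSpace K']
    [SecondCountableTopology K'] [MeasurableSpace K'] [BorelSpace K']
    [NormedAddCommGroup H] [InnerProductSpace ℝ H] [CompleteSpace H] [SecondCountableTopology H]
    [MeasurableSpace H] [BorelSpace H]
    (L : H →ₗ.[ℝ] H) (S : ℝ → H →L[ℝ] H) (Q : K →L[ℝ] H)
    (hS : LinearSPDE.IsC0Semigroup S) (hL : LinearSPDE.IsGenerator L S)
    (ι : K →L[ℝ] K') (W : ℝ≥0 → Ω → K') (hW : LinearSPDE.IsCylindricalWiener P ι W)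
    (hsol : ∀ x₀ : H, ∃ x : ℝ → Ω → H, LinearSPDE.IsMildSolution P ι W S Q x₀ x)
    (T : ℝ) (hT : 0 ≤ T) (hnorm : ‖S T‖ < 1)
    (R : H →L[ℝ] H) (hR : LinearSPDE.IsPositiveSqrt R (LinearSPDE.covOp S Q T))
    (hrange : Set.range (S T) ⊆ Set.range R) :
    ∃ μ : Measure H, LinearSPDE.IsInvariantMeasure P ι W S Q μ ∧
      (∀ μ' : Measure H, LinearSPDE.IsInvariantMeasure P ι W S Q μ' → μ' = μ) ∧
      ∃ γ : ℝ, 0 < γ ∧ ∀ ν : Measure H, IsProbabilityMeasure ν → MemLp (fun x : H => x) 2 ν →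
        ∃ C : ℝ, ∀ t : ℝ, 0 ≤ t →
          LinearSPDE.tvDist (LinearSPDE.evolve P ι W S Q t ν) μ
            ≤ ENNReal.ofReal (C * Real.exp (-γ * t)) := by
  obtain ⟨T', hT', hnorm', hR', hrange'⟩ : ∃ T' : ℝ, 0 < T' ∧ ‖S T'‖ < 1 ∧
      LinearSPDE.IsPositiveSqrt R (LinearSPDE.covOp S Q T') ∧ Set.range (S T') ⊆ Set.range R := by
    -- At `T = 0` the bound `‖id‖ < 1` forces `H` to be trivial, and then the hypotheses hold at
    -- time `1` as well.
    rcases hT.eq_or_lt with rfl | hT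
    · have hsub : Subsingleton H := by
        by_contra hns
        have := not_subsingleton_iff_nontrivial.1 hns
        rw [hS.map_zero, ContinuousLinearMap.norm_id] at hnorm
        exact lt_irrefl _ hnorm
      rw [Subsingleton.elim (LinearSPDE.covOp S Q 0) (LinearSPDE.covOp S Q 1)] at hR
      rw [Subsingleton.elim (S 0) (S 1)] at hnorm hrange
      exact ⟨1, one_pos, hnorm, hR, hrange⟩
    · exact ⟨T, hT, hnorm, hR, hrange⟩
  obtain ⟨μ, hμ, huniq, γ, hγ, hmix⟩ :=
    LinearSPDE.exists_exponentially_mixing hS hW hsol hT' hnorm' hR' hrange'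
  refine ⟨μ, hμ, huniq, γ, hγ, fun ν hν hν2 => ?_⟩
  obtain ⟨C, hC⟩ := hmix ν hν (hν2.integrable one_le_two)
  exact ⟨C, fun t ht => (hC t ht).tvDist_le⟩
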